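/- A *class* of Boolean functions is a set of families $f=(f_n)_{n\ge 0}$ with $f_n:\{0,1\}^n\to\{0,1\}$. Let $\mathrm{sign}(t)=1$ if $t>0$ and $\mathrm{sign}(t)=0$ if $t\le 0$. A quantity is of polynomial size (polynomially bounded) if for every number $n$ of variables it is at most $p(n)$, where $p$ is a polynomial depending only on the family. * A linear decision list of size $k\ge 1$ in $n$ variables is a sequence $(L_1,a_1),\dots,(L_k,a_k)$ with $a_i\in\{0,1\}$ and linear threshold functions $L_i(x)=\mathrm{sign}(w_{i,0}+\sum_{j=1}^n w_{i,j}x_j)$, $w_{i,j}\in\mathbb R$, where $L_k$ is the constant function $1$; on input $x$ it outputs $a_i$ for the least $i$ with $L_i(x)=1$. $\mathsf{LDL}$ is the class of all families computed by linear decision lists of polynomial size. $\widehat{\mathsf{LDL}}$ is the class of all families computed by linear decision lists of polynomial size in which all the $w_{i,j}$ are integers with absolute value bounded by a polynomial in $n$. * A majority gate of fan-in $k$ outputs $\mathsf{MAJ}_k(y_1,\dots,y_k)=\mathrm{sign}(y_1+\dots+y_k-k/2)$. $\mathsf{MAJ}\circ\mathsf{MAJ}$ is the class of all families computed by depth-two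 circuits of polynomial size (number of gates and wires) with a majority gate at the top and majority gates in the bottom layer; the inputs of a bottom gate are constants, variables and negated variables, those of the top gate are constants and outputs, possibly negated, of bottom gates; inputs may be repeated. * $\mathsf{PL}_1$ is the class of all families for which $\sum_{S\subseteq[n]}|\widehat{f_n}(S)|$ is polynomially bounded in $n$, where $\widehat{f_n}(S)=2^{-n}\sum_{x\in\{0,1\}^n}f_n(x)(-1)^{\sum_{i\in S}x_i}$. Two classes $A$, $B$ are incomparable if $A\not\subseteq B$ and $B\not\subseteq A$. **Corollary.** For every $A\in\{\widehat{\mathsf{LDL}},\mathsf{LDL}\}$ and every $B\in\{\mathsf{PL}_1,\mathsf{MAJ}\circ\mathsf{MAJ}\}$, the classes $A$ and $B$ are incomparable. In particular, $\mathsf{LDL}$ and $\mathsf{MAJ}\circ\mathsf{MAJ}$ are incomparable. -/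

import Mathlib

namespace LinearLists

/-- A family of Boolean functions, one `f n : {0,1}ⁿ → {0,1}` for each number `n` of variables.
A class of Boolean functions is a set of such families. -/
abbrev BoolFamily : Type := (n : ℕ) → (Fin n → Bool) → Bool

/-- The bit `b` as a real number. -/
def bit (b : Bool) : ℝ := if b then 1 else 0

/-- `sgn t = 1` if `t > 0`, and `sgn t = 0` if `t ≤ 0`. -/
noncomputable def sgn (t : ℝ) : Bool := decide (0 < t)

/-! ### Linear decision lists -/

/-- A linear threshold query `sgn (w₀ + ∑ wᵢ xᵢ)` in `n` variables. -/
structure LinThr (n : ℕ) where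
  /-- the constant term `w₀` -/
  bias : ℝ
  /-- the weights `w₁, …, wₙ` -/
  weight : Fin n → ℝ

/-- The linear threshold function given by a query. -/
noncomputable def LinThr.eval {n : ℕ} (L : LinThr n) (x : Fin n → Bool) : Bool :=
  sgn (L.bias + ∑ i, L.weight i * bit (x i))

/-- All the weights (and the constant term) are integers of absolute value at most `W`. -/
def LinThr.IntWeightsLE {n : ℕ} (L : LinThr n) (W : ℕ) : Prop :=
  (∃ z : ℤ, L.bias = z ∧ |z| ≤ W) ∧ ∀ i, ∃ z : ℤ, L.weight i = z ∧ |z| ≤ W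

/-- The answer `aᵢ` of the first pair `(Lᵢ, aᵢ)` of the list with `Lᵢ(x) = 1`. (The value on the
empty list is irrelevant: in a linear decision list some query always answers `1`.) -/
noncomputable def listEval {n : ℕ} : List (LinThr n × Bool) → (Fin n → Bool) → Bool
  | [], _ => false
  | q :: l, x => if q.1.eval x = true then q.2 else listEval l x

/-- A sequence `(L₁, a₁), …, (L_k, a_k)` is a linear decision list if `k ≥ 1` and `L_k` is the
constant function `1`. Its size is `k`, the length of the list. -/
def IsLinearDecisionList {n : ℕ} (l : List (LinThr n × Bool)) : Prop :=
  ∃ h : l ≠ [], ∀ x, (l.getLast h).1.eval x = true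

/-- `LDL`: families computable by linear decision lists of polynomial size. -/
def LDL : Set BoolFamily :=
  {f | ∃ p : Polynomial ℕ, ∀ n, ∃ l : List (LinThr n × Bool),
    IsLinearDecisionList l ∧ l.length ≤ p.eval n ∧ ∀ x, listEval l x = f n x}

/-- `LDL-hat`: families computable by linear decision lists of polynomial size whose queries
have integer weights bounded by a polynomial in the number of variables. -/
def LDLhat : Set BoolFamily :=
  {f | ∃ p q : Polynomial ℕ, ∀ n, ∃ l : List (LinThr n × Bool),
    IsLinearDecisionList l ∧ l.length ≤ p.eval n ∧
      (∀ Q ∈ l, Q.1.IntWeightsLE (q.eval n)) ∧ ∀ x, listEval l x = f n x}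

/-! ### Depth-two majority circuits -/

/-- An input of a majority gate over `m` variables: a constant, a variable or a negated one. -/
inductive MajInput (m : ℕ) : Type
  | const (b : Bool) : MajInput m
  | var (i : Fin m) : MajInput m
  | neg (i : Fin m) : MajInput m

/-- The value of an input of a majority gate. -/
def MajInput.eval {m : ℕ} : MajInput m → (Fin m → Bool) → Bool
  | .const b, _ => b
  | .var i, y => y i
  | .neg i, y => !(y i)

/-- A majority gate over `m` variables is the list of its inputs, in which repetitions are
allowed; the length of the list is the fan-in. -/
abbrev MajGate (m : ℕ) : Type := List (MajInput m)

/-- The value `MAJ_k (y₁, …, y_k) = sgn (y₁ + ⋯ + y_k - k / 2)` of a majority gate of fan-in `k`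
with input values `y₁, …, y_k`. -/
noncomputable def MajGate.eval {m : ℕ} (g : MajGate m) (y : Fin m → Bool) : Bool :=
  sgn ((g.map fun u => bit (u.eval y)).sum - (g.length : ℝ) / 2)

/-- A depth-two circuit over `n` variables with a majority gate at the top, whose inputs are
constants and (possibly negated) outputs of majority gates of the bottom layer. -/
structure MajMajCircuit (n : ℕ) where
  /-- the number of gates in the bottom layer -/
  width : ℕ
  /-- the bottom layer -/
  bottom : Fin width → MajGate n
  /-- the top gate -/
  top : MajGate width

/-- The function computed by a depth-two majority circuit. -/
noncomputable def MajMajCircuit.eval {n : ℕ} (C : MajMajCircuit n) (x : Fin n → Bool) : Bool :=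
  MajGate.eval C.top fun j => MajGate.eval (C.bottom j) x

/-- The size of a depth-two majority circuit: the number of gates plus the number of wires,
with multiplicity. -/
def MajMajCircuit.size {n : ℕ} (C : MajMajCircuit n) : ℕ :=
  (C.width + 1) + (C.top.length + ∑ j, (C.bottom j).length)

/-- `MAJ ∘ MAJ`: families computable by depth-two majority circuits of polynomial size. -/
def MAJMAJ : Set BoolFamily :=
  {f | ∃ p : Polynomial ℕ, ∀ n, ∃ C : MajMajCircuit n,
    C.size ≤ p.eval n ∧ ∀ x, C.eval x = f n x}

/-! ### The spectral class -/

/-- The character `χ_S(x) = (-1) ^ (∑_{i ∈ S} xᵢ)`. -/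
def chi {n : ℕ} (S : Finset (Fin n)) (x : Fin n → Bool) : ℝ :=
  (-1) ^ (∑ i ∈ S, (x i).toNat)

/-- The Fourier coefficient `E_x [f(x) χ_S(x)]` of `f : {0,1}ⁿ → {0,1}`. -/
noncomputable def fourierCoeffBool {n : ℕ} (f : (Fin n → Bool) → Bool) (S : Finset (Fin n)) : ℝ :=
  (1 / 2 ^ n) * ∑ x : Fin n → Bool, bit (f x) * chi S x

/-- `PL₁`: families whose sum of absolute values of Fourier coefficients is polynomially
bounded. -/
def PL1 : Set BoolFamily :=
  {f | ∃ p : Polynomial ℕ, ∀ n,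
    ∑ S : Finset (Fin n), |fourierCoeffBool (f n) S| ≤ ((p.eval n : ℕ) : ℝ)}

/-- Two classes are incomparable if neither contains the other. -/
def Incomparable (A B : Set BoolFamily) : Prop := ¬ A ⊆ B ∧ ¬ B ⊆ A

end LinearLists

/-!
Three explicit families, each built on disjoint pairs of variables, separate the classes. Giving the
even variables to one player and the odd ones to another turns each family into a matrix.

**Outside `LDL`.** A threshold query is the sign of `u (row) + v (column)`. Hence either it accepts
the whole product of the `p` rows of largest `u` and the `p` columns of largest `v`, or it rejects
the product of all the other rows and columns. By induction a list of length `k` is constant on a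
square of side about `1 / k` times that of the matrix (`IsLinearDecisionList.exists_rectangle`). Two
families have no such squares.

* `majXor`, the majority of the parities of the pairs, is in `MAJ ∘ MAJ` because a parity of two
  bits is a difference of two majority gates. A monochromatic square would give two large sets of
  strings at mutual distance at least half the length, against
  `card_mul_card_le_of_hammingDist_ge`.
* `sinkXor` asks whether a tournament, whose arcs are the parities, has a sink. A tournament has at
  most one sink, so the indicator is a sum of conjunctions of parity constraints, each of spectral
  norm at most `1`; thus it is in `PL₁`. In a square `A × B` of zeros, for every vertex the hulls of
  `A` and `B` on the arcs at that vertex are disjoint up to translation, so the product of their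
  densities is at most `1 / 4`. Since an arc has two ends, Finner's inequality `sq_avg_prod_le`
  bounds the density of a set by the densities of its hulls, and `A` and `B` cannot both be large.
  Squares of ones are small because there are few ones.

**Outside `PL₁` and `MAJ ∘ MAJ`.** The family `firstActive`, which returns the parity of the index
of the first pair equal to `11`, is a linear decision list by definition. A function in `PL₁` or
`MAJ ∘ MAJ` cannot agree in sign with a matrix of mass `1` that is nearly orthogonal to all
rectangles (`DiscLE.abs_pairing_bit_le`, `DiscLE.le_of_circuit`). Such a matrix is built from a
block of gadgets computing bits of strings held by the row at positions held by the column. A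
combination of product distributions of gadget outputs, with biases in geometric progression, can
annihilate all low-degree parities (`exists_moment_weights`), while parities of high degree have
small discrepancy by Cauchy's inequality (`discLE_prod_gadget`). So, up to a negligible
discrepancy, the distribution `D` on blocks of zeros equals `Q - P`, where `Q` lives on nonzero
blocks and `P` is a measure of mass at most `1 / 2` (`exists_hardBlock`). Substituting this
repeatedly, `D ⊗ ⋯ ⊗ D` telescopes to an alternating sum of terms `D ⊗ ⋯ ⊗ D ⊗ Q ⊗ P ⊗ ⋯ ⊗ P` and
a remainder `± P ⊗ ⋯ ⊗ P` of exponentially small mass. In each term the first nonzero block is the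
one carrying `Q`, so the signs alternate with its position exactly as those of `firstActive` do
(`exists_hard_matrix`).
-/

namespace LinearLists

/-! ### Inputs split between two players -/

/-- The value of the `j`-th variable, with the value `false` for `j` out of range. -/
def getBit {n : ℕ} (x : Fin n → Bool) (j : ℕ) : Bool := if h : j < n then x ⟨j, h⟩ else false

/-- The input whose variables with even index `2t` carry the bits `a t` and whose variables with
odd index `2t + 1` carry the bits `b t`. -/
def interleave (n : ℕ) (a b : ℕ → Bool) : Fin n → Bool :=
  fun j => if (j : ℕ) % 2 = 0 then a (j / 2) else b (j / 2)

theorem getBit_interleave_even {n : ℕ} (a b : ℕ → Bool) {t : ℕ} (h : 2 * t < n) :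
    getBit (interleave n a b) (2 * t) = a t := by
  simp [getBit, interleave, h]

theorem getBit_interleave_odd {n : ℕ} (a b : ℕ → Bool) {t : ℕ} (h : 2 * t + 1 < n) :
    getBit (interleave n a b) (2 * t + 1) = b t := by
  have h1 : (2 * t + 1) / 2 = t := by omega
  simp [getBit, interleave, h, h1]

theorem getBit_of_le {n : ℕ} (x : Fin n → Bool) {j : ℕ} (h : n ≤ j) : getBit x j = false := by
  simp [getBit, Nat.not_lt.mpr h]

theorem bit_nonneg (b : Bool) : 0 ≤ bit b := by cases b <;> simp [bit]

theorem bit_le_one (b : Bool) : bit b ≤ 1 := by cases b <;> simp [bit]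

/-- On interleaved inputs an affine form is the sum of a function of the first half and a function
of the second half. -/
theorem exists_affine_split {n : ℕ} (L : LinThr n) :
    ∃ u v : (ℕ → Bool) → ℝ, ∀ a b,
      L.bias + ∑ i, L.weight i * bit (interleave n a b i) = u a + v b := by
  refine ⟨fun a => L.bias +
      ∑ i : Fin n, if (i : ℕ) % 2 = 0 then L.weight i * bit (a (i / 2)) else 0,
    fun b => ∑ i : Fin n, if (i : ℕ) % 2 = 0 then 0 else L.weight i * bit (b (i / 2)), ?_⟩
  intro a b
  rw [add_assoc, ← Finset.sum_add_distrib]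
  congr 1
  refine Finset.sum_congr rfl fun i _ => ?_
  by_cases h : (i : ℕ) % 2 = 0 <;> simp [interleave, h]

/-- A polynomial with natural coefficients is dominated by a power on the integers `≥ 2`. -/
theorem exists_eval_le_pow (p : Polynomial ℕ) : ∃ e : ℕ, ∀ n, 2 ≤ n → p.eval n ≤ n ^ e := by
  induction p using Polynomial.induction_on' with
  | add p q hp hq =>
    obtain ⟨e, he⟩ := hp
    obtain ⟨e', he'⟩ := hq
    refine ⟨max e e' + 1, fun n hn => ?_⟩
    have h1 := (he n hn).trans (Nat.pow_le_pow_right (by omega) (le_max_left e e'))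
    have h2 := (he' n hn).trans (Nat.pow_le_pow_right (by omega) (le_max_right e e'))
    rw [Polynomial.eval_add, pow_succ]
    nlinarith [Nat.zero_le (n ^ max e e')]
  | monomial k a =>
    refine ⟨k + a, fun n hn => ?_⟩
    rw [Polynomial.eval_monomial, pow_add, mul_comm]
    exact Nat.mul_le_mul_left _ (Nat.lt_pow_self (by omega)).le

theorem LDLhat_subset_LDL : LDLhat ⊆ LDL := by
  rintro f ⟨p, q, h⟩
  refine ⟨p, fun n => ?_⟩
  obtain ⟨l, h1, h2, -, h3⟩ := h n
  exact ⟨l, h1, h2, h3⟩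

/-! ### Monochromatic rectangles of linear decision lists -/

theorem exists_top_subset {X : Type*} [DecidableEq X] (f : X → ℝ) (s : Finset X) (p : ℕ)
    (hp : p ≤ s.card) :
    ∃ t ⊆ s, t.card = p ∧ ∀ a ∈ t, ∀ b ∈ s \ t, f b ≤ f a := by
  induction p with
  | zero => exact ⟨∅, by simp, by simp, by simp⟩
  | succ p ih =>
    obtain ⟨t, hts, htc, ht⟩ := ih (by omega)
    have hne : (s \ t).Nonempty := by
      rw [← Finset.card_pos, Finset.card_sdiff_of_subset hts]; omega
    obtain ⟨c, hc, hmax⟩ := Finset.exists_max_image (s \ t) f hne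
    have hc' := Finset.mem_sdiff.mp hc
    refine ⟨insert c t, Finset.insert_subset hc'.1 hts, by
      rw [Finset.card_insert_of_notMem hc'.2, htc], fun a ha b hb => ?_⟩
    have hb' : b ∈ s \ t := by
      simp only [Finset.mem_sdiff, Finset.mem_insert, not_or] at hb ⊢
      exact ⟨hb.1, hb.2.2⟩
    rcases Finset.mem_insert.mp ha with rfl | ha
    · exact hmax b hb'
    · exact ht a ha b hb'

/-- One step of the rectangle argument: either the query accepts the product of the `p` rows and
`p` columns of largest potential, or it rejects the product of all the others. -/
theorem exists_rectangle_aux {n : ℕ} {X Y : Type*} (α : X → ℕ → Bool) (β : Y → ℕ → Bool)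
    (p : ℕ) (l : List (LinThr n × Bool)) :
    ∀ (R : Finset X) (C : Finset Y), l.length * p < R.card → l.length * p < C.card →
      (∀ x ∈ R, ∀ y ∈ C, ∃ q ∈ l, q.1.eval (interleave n (α x) (β y)) = true) →
      ∃ A ⊆ R, ∃ B ⊆ C, ∃ c : Bool, A.card = p ∧ B.card = p ∧
        ∀ x ∈ A, ∀ y ∈ B, listEval l (interleave n (α x) (β y)) = c := by
  classical
  induction l with
  | nil =>
    intro R C hR hC h
    obtain ⟨x, hx⟩ := Finset.card_pos.mp (by simpa using hR : 0 < R.card)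
    obtain ⟨y, hy⟩ := Finset.card_pos.mp (by simpa using hC : 0 < C.card)
    simpa using h x hx y hy
  | cons q l ih =>
    intro R C hR hC h
    rw [List.length_cons, add_mul, one_mul] at hR hC
    obtain ⟨u, v, huv⟩ := exists_affine_split q.1
    obtain ⟨A, hA, hAc, hAm⟩ := exists_top_subset (fun x => u (α x)) R p (by omega)
    obtain ⟨B, hB, hBc, hBm⟩ := exists_top_subset (fun y => v (β y)) C p (by omega)
    by_cases hall : ∀ x ∈ A, ∀ y ∈ B, q.1.eval (interleave n (α x) (β y)) = true
    · exact ⟨A, hA, B, hB, q.2, hAc, hBc, fun x hx y hy => by rw [listEval, if_pos (hall x hx y hy)]⟩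
    · push Not at hall
      obtain ⟨x₀, hx₀, y₀, hy₀, h₀⟩ := hall
      have hrej : ∀ x ∈ R \ A, ∀ y ∈ C \ B, ¬ q.1.eval (interleave n (α x) (β y)) = true := by
        intro x hx y hy
        simp only [LinThr.eval, huv, sgn, decide_eq_true_eq, not_lt, ne_eq] at h₀ ⊢
        exact (add_le_add (hAm x₀ hx₀ x hx) (hBm y₀ hy₀ y hy)).trans h₀
      obtain ⟨A', hA', B', hB', c, h1, h2, h3⟩ := ih (R \ A) (C \ B)
        (by rw [Finset.card_sdiff_of_subset hA]; omega)
        (by rw [Finset.card_sdiff_of_subset hB]; omega)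
        (by
          intro x hx y hy
          obtain ⟨q', hq', hq'e⟩ :=
            h x (Finset.mem_sdiff.mp hx).1 y (Finset.mem_sdiff.mp hy).1
          rcases List.mem_cons.mp hq' with rfl | hq'
          · exact absurd hq'e (hrej x hx y hy)
          · exact ⟨q', hq', hq'e⟩)
      refine ⟨A', hA'.trans Finset.sdiff_subset, B', hB'.trans Finset.sdiff_subset, c, h1, h2,
        fun x hx y hy => ?_⟩
      rw [listEval, if_neg (hrej x (hA' hx) y (hB' hy))]
      exact h3 x hx y hy

/-- A linear decision list of length `< |X| / p, |Y| / p` is constant on a `p × p` rectangle,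
whichever half of the variables is given to the rows and to the columns. -/
theorem IsLinearDecisionList.exists_rectangle {n : ℕ} {X Y : Type*} [Fintype X] [Fintype Y]
    (α : X → ℕ → Bool) (β : Y → ℕ → Bool) {l : List (LinThr n × Bool)}
    (hl : IsLinearDecisionList l) {p : ℕ} (hX : l.length * p < Fintype.card X)
    (hY : l.length * p < Fintype.card Y) :
    ∃ (A : Finset X) (B : Finset Y) (c : Bool), A.card = p ∧ B.card = p ∧
      ∀ x ∈ A, ∀ y ∈ B, listEval l (interleave n (α x) (β y)) = c := by
  obtain ⟨hne, hlast⟩ := hl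
  obtain ⟨A, -, B, -, c, h⟩ := exists_rectangle_aux α β p l Finset.univ Finset.univ hX hY
    fun x _ y _ => ⟨l.getLast hne, List.getLast_mem hne, hlast _⟩
  exact ⟨A, B, c, h⟩

/-- A family is outside `LDL` if, for every exponent `e`, for some `n` the two-party version of its
`n`-th function on pairs of `M`-bit strings has no monochromatic square of side `2 ^ (M - r)`,
for some `r` with `n ^ e < 2 ^ r`. -/
theorem notMem_LDL_of_no_rectangle {f : BoolFamily}
    (h : ∀ e : ℕ, ∃ n M r : ℕ, 2 ≤ n ∧ r ≤ M ∧ n ^ e < 2 ^ r ∧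
      ∀ (A B : Finset (Fin M → Bool)) (c : Bool), A.card = 2 ^ (M - r) → B.card = 2 ^ (M - r) →
        (∀ x ∈ A, ∀ y ∈ B, f n (interleave n (getBit x) (getBit y)) = c) → False) :
    f ∉ LDL := by
  rintro ⟨p, hp⟩
  obtain ⟨e, he⟩ := exists_eval_le_pow p
  obtain ⟨n, M, r, hn, hrM, hne, hno⟩ := h e
  obtain ⟨l, hl, hlen, hlf⟩ := hp n
  have hcard : l.length * 2 ^ (M - r) < Fintype.card (Fin M → Bool) := by
    simp only [Fintype.card_pi, Fintype.card_bool, Finset.prod_const, Finset.card_univ,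
      Fintype.card_fin]
    calc l.length * 2 ^ (M - r) < 2 ^ r * 2 ^ (M - r) :=
          Nat.mul_lt_mul_of_pos_right ((hlen.trans (he n hn)).trans_lt hne) (by positivity)
      _ = 2 ^ M := by rw [← pow_add]; congr 1; omega
  obtain ⟨A, B, c, hA, hB, hc⟩ := hl.exists_rectangle getBit getBit hcard hcard
  exact hno A B c hA hB fun x hx y hy => by rw [← hlf]; exact hc x hx y hy

/-! ### Majority of parities -/

theorem sum_fin_succ_pi {M : Type*} [AddCommMonoid M] {n : ℕ} {α : Type*} [Fintype α]
    (F : (Fin (n + 1) → α) → M) :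
    ∑ x, F x = ∑ a : α, ∑ x : Fin n → α, F (Fin.cons a x) := by
  rw [← Fintype.sum_prod_type' (f := fun a (x : Fin n → α) => F (Fin.cons a x))]
  exact (Fintype.sum_equiv (Fin.consEquiv fun _ => α) _ _ fun _ => rfl).symm

/-- The strings whose extension by the first letter `b` belongs to `A`. -/
def slice {n : ℕ} (A : Finset (Fin (n + 1) → Bool)) (b : Bool) : Finset (Fin n → Bool) :=
  {x | (Fin.cons b x : Fin (n + 1) → Bool) ∈ A}

theorem mem_slice {n : ℕ} {A : Finset (Fin (n + 1) → Bool)} {b : Bool} {x : Fin n → Bool} :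
    x ∈ slice A b ↔ (Fin.cons b x : Fin (n + 1) → Bool) ∈ A := by simp [slice]

theorem card_eq_card_slice {n : ℕ} (A : Finset (Fin (n + 1) → Bool)) :
    A.card = (slice A true).card + (slice A false).card := by
  have h : ∀ {k : ℕ} (B : Finset (Fin k → Bool)), B.card = ∑ x, if x ∈ B then 1 else 0 := by
    intro k B; simp
  rw [h A, sum_fin_succ_pi, Fintype.sum_bool, h (slice A true), h (slice A false)]
  simp only [mem_slice]

theorem hammingDist_cons {n : ℕ} (a b : Bool) (x y : Fin n → Bool) :
    hammingDist (Fin.cons a x : Fin (n + 1) → Bool) (Fin.cons b y) =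
      (if a = b then 0 else 1) + hammingDist x y := by
  simp only [hammingDist, Finset.card_filter]
  rw [Fin.sum_univ_succ]
  simp

/-- Two sets of strings at distance at least `d` from each other cannot both be large. The number
`25 / 4 = 2 + 4 + 1 / 4` comes from weighting distances by powers of `4`. -/
theorem card_mul_card_le_of_hammingDist_ge {n : ℕ} : ∀ (d : ℕ) (A B : Finset (Fin n → Bool)),
    (∀ a ∈ A, ∀ b ∈ B, d ≤ hammingDist a b) →
      (A.card : ℝ) * B.card * 4 ^ d * 4 ^ n ≤ 25 ^ n := by
  induction n with
  | zero =>
    intro d A B h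
    rcases Finset.eq_empty_or_nonempty A with rfl | ⟨a, ha⟩
    · simp
    rcases Finset.eq_empty_or_nonempty B with rfl | ⟨b, hb⟩
    · simp
    have hd : d = 0 := by
      have h1 := h a ha b hb
      rw [Subsingleton.elim a b, hammingDist_self] at h1
      omega
    have hA : (A.card : ℝ) ≤ 1 := by exact_mod_cast Finset.card_le_one_of_subsingleton A
    have hB : (B.card : ℝ) ≤ 1 := by exact_mod_cast Finset.card_le_one_of_subsingleton B
    subst hd
    simpa using mul_le_one₀ hA (by positivity) hB
  | succ n ih =>
    intro d A B h
    rcases d with _ | d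
    · have hc : ∀ C : Finset (Fin (n + 1) → Bool), (C.card : ℝ) ≤ 2 ^ (n + 1) := by
        intro C
        have h1 := Finset.card_le_univ C
        simp only [Fintype.card_pi, Fintype.card_bool, Finset.prod_const, Finset.card_univ,
          Fintype.card_fin] at h1
        exact_mod_cast h1
      calc (A.card : ℝ) * B.card * 4 ^ 0 * 4 ^ (n + 1)
          ≤ 2 ^ (n + 1) * 2 ^ (n + 1) * 4 ^ 0 * 4 ^ (n + 1) := by
            gcongr <;> exact hc _
        _ = 16 ^ (n + 1) := by rw [pow_zero, mul_one, ← mul_pow, ← mul_pow]; norm_num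
        _ ≤ 25 ^ (n + 1) := by gcongr; norm_num
    have same : ∀ e, ((slice A e).card : ℝ) * (slice B e).card * 4 ^ (d + 1) * 4 ^ n ≤ 25 ^ n :=
      fun e => ih (d + 1) _ _ fun a ha b hb => by
        have := h _ (mem_slice.mp ha) _ (mem_slice.mp hb)
        rw [hammingDist_cons] at this
        simpa using this
    have diff : ∀ e e', e ≠ e' →
        ((slice A e).card : ℝ) * (slice B e').card * 4 ^ d * 4 ^ n ≤ 25 ^ n :=
      fun e e' he => ih d _ _ fun a ha b hb => by
        have := h _ (mem_slice.mp ha) _ (mem_slice.mp hb)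
        rw [hammingDist_cons, if_neg he] at this
        omega
    have h0 := same true
    have h1 := same false
    have h2 := diff true false (by simp)
    have h3 := diff false true (by simp)
    rw [card_eq_card_slice A, card_eq_card_slice B]
    push_cast
    have ha₁ : (0 : ℝ) ≤ (slice A true).card := by positivity
    have ha₀ : (0 : ℝ) ≤ (slice A false).card := by positivity
    have hb₁ : (0 : ℝ) ≤ (slice B true).card := by positivity
    have hb₀ : (0 : ℝ) ≤ (slice B false).card := by positivity
    generalize ((slice A true).card : ℝ) = a₁ at *
    generalize ((slice A false).card : ℝ) = a₀ at *
    generalize ((slice B true).card : ℝ) = b₁ at *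
    generalize ((slice B false).card : ℝ) = b₀ at *
    have hM : (0 : ℝ) < 25 ^ n := by positivity
    rw [pow_succ] at h0 h1
    rw [pow_succ (4 : ℝ) d, pow_succ (4 : ℝ) n, pow_succ (25 : ℝ) n]
    generalize (25 : ℝ) ^ n = M at *
    have hK : (0 : ℝ) < 4 ^ d * 4 ^ n := by positivity
    obtain ⟨K, hKdef⟩ : ∃ K : ℝ, K = 4 ^ d * 4 ^ n := ⟨_, rfl⟩
    rw [← hKdef] at hK
    have e0 : a₁ * b₁ * K * 4 ≤ M := by rw [hKdef]; linarith
    have e1 : a₀ * b₀ * K * 4 ≤ M := by rw [hKdef]; linarith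
    have e2 : a₁ * b₀ * K ≤ M := by rw [hKdef]; linarith
    have e3 : a₀ * b₁ * K ≤ M := by rw [hKdef]; linarith
    have hprod : (a₁ * b₀ * K) * (a₀ * b₁ * K) * 16 ≤ M * M := by
      have := mul_le_mul e0 e1 (by positivity) hM.le
      linarith
    -- the cross terms are at most `M` and their product is at most `M ^ 2 / 16`
    have hcross : a₁ * b₀ * K + a₀ * b₁ * K ≤ 17 / 16 * M := by
      have := mul_nonneg (sub_nonneg.mpr e2) (sub_nonneg.mpr e3)
      nlinarith
    have : (a₁ + a₀) * (b₁ + b₀) * (4 ^ d * 4) * (4 ^ n * 4) =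
        4 * (a₁ * b₁ * K * 4) + 4 * (a₀ * b₀ * K * 4) + 16 * (a₁ * b₀ * K + a₀ * b₁ * K) := by
      rw [hKdef]; ring
    rw [this]
    linarith

/-- The parity of the `t`-th pair of variables. -/
def xorPair {n : ℕ} (x : Fin n → Bool) (t : ℕ) : Bool :=
  xor (getBit x (2 * t)) (getBit x (2 * t + 1))

theorem xorPair_interleave {n : ℕ} (a b : ℕ → Bool) {t : ℕ} (h : 2 * t + 1 < n) :
    xorPair (interleave n a b) t = xor (a t) (b t) := by
  rw [xorPair, getBit_interleave_even _ _ (by omega), getBit_interleave_odd _ _ h]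

/-- The family `MAJ ∘ XOR`: the majority of the parities of the disjoint pairs of variables. -/
def majXor : BoolFamily := fun n x =>
  decide (n / 2 < 2 * ((Finset.range (n / 2)).filter fun t => xorPair x t = true).card)

theorem majGate_or {n : ℕ} (i j : Fin n) (x : Fin n → Bool) :
    MajGate.eval [.var i, .var j, .const true] x = (x i || x j) := by
  cases hi : x i <;> cases hj : x j <;> norm_num [MajGate.eval, MajInput.eval, hi, hj, bit, sgn]

theorem majGate_and {n : ℕ} (i j : Fin n) (x : Fin n → Bool) :
    MajGate.eval [.var i, .var j] x = (x i && x j) := by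
  cases hi : x i <;> cases hj : x j <;> norm_num [MajGate.eval, MajInput.eval, hi, hj, bit, sgn]

/-- A majority circuit for `MAJ ∘ XOR`: since `a ⊕ b + 1 = (a ∨ b) + ¬ (a ∧ b)`, the top gate counts
disjunctions and negated conjunctions; constants `0` adjust its threshold. -/
def majXorCircuit (n : ℕ) : MajMajCircuit n where
  width := n / 2 + n / 2
  bottom := Fin.addCases
    (fun i => [.var ⟨2 * i, by omega⟩, .var ⟨2 * i + 1, by omega⟩, .const true])
    (fun i => [.var ⟨2 * i, by omega⟩, .var ⟨2 * i + 1, by omega⟩])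
  top := (List.ofFn fun i : Fin (n / 2) => MajInput.var (Fin.castAdd (n / 2) i)) ++
    (List.ofFn fun i : Fin (n / 2) => MajInput.neg (Fin.natAdd (n / 2) i)) ++
    List.replicate (n / 2) (MajInput.const false)

theorem majXorCircuit_eval (n : ℕ) (x : Fin n → Bool) :
    (majXorCircuit n).eval x = majXor n x := by
  have hcard : (((Finset.range (n / 2)).filter fun t => xorPair x t = true).card : ℝ) =
      ∑ i : Fin (n / 2), bit (xorPair x i) := by
    rw [Finset.card_filter, Finset.sum_range]
    push_cast
    exact Finset.sum_congr rfl fun i _ => by simp [bit]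
  have hpair : ∀ i : Fin (n / 2), bit (x ⟨2 * i, by omega⟩ || x ⟨2 * i + 1, by omega⟩) +
      bit (!(x ⟨2 * i, by omega⟩ && x ⟨2 * i + 1, by omega⟩)) = bit (xorPair x i) + 1 := by
    intro i
    have h1 : 2 * (i : ℕ) < n := by omega
    have h2 : 2 * (i : ℕ) + 1 < n := by omega
    simp only [xorPair, getBit, h1, h2, dif_pos]
    cases x ⟨2 * i, h1⟩ <;> cases x ⟨2 * i + 1, h2⟩ <;> norm_num [bit]
  have hsum := Finset.sum_congr (rfl : (Finset.univ : Finset (Fin (n / 2))) = _)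
    fun i _ => hpair i
  rw [Finset.sum_add_distrib, Finset.sum_add_distrib, ← hcard] at hsum
  simp only [majXor, MajMajCircuit.eval, MajGate.eval.eq_1 (majXorCircuit n).top]
  simp only [majXorCircuit, List.map_append, List.sum_append, List.map_ofFn, List.sum_ofFn,
    Function.comp_def, MajInput.eval, Fin.addCases_left, Fin.addCases_right, majGate_or,
    majGate_and, List.map_replicate, List.sum_replicate, List.length_append, List.length_ofFn,
    List.length_replicate, hsum]
  refine decide_eq_decide.mpr ?_
  rw [show bit false = 0 from rfl, ← Nat.cast_lt (α := ℝ)]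
  push_cast
  simp only [Finset.sum_const, Finset.card_univ, Fintype.card_fin, nsmul_eq_mul, mul_one, mul_zero]
  constructor <;> intro h <;> linarith

theorem majXor_mem_MAJMAJ : majXor ∈ MAJMAJ := by
  refine ⟨5 * Polynomial.X + 1, fun n => ⟨majXorCircuit n, ?_, majXorCircuit_eval n⟩⟩
  have h : ∑ j, ((majXorCircuit n).bottom j).length = n / 2 * 3 + n / 2 * 2 := by
    refine (Fin.sum_univ_add (a := n / 2) (b := n / 2) _).trans ?_
    simp only [majXorCircuit, Fin.addCases_left, Fin.addCases_right, List.length_cons,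
      List.length_nil, Finset.sum_const, Finset.card_univ, Fintype.card_fin, smul_eq_mul]
  rw [MajMajCircuit.size, h]
  simp [majXorCircuit]
  omega

theorem exists_linear_lt_two_pow (a b : ℕ) : ∃ j, 1 ≤ j ∧ a * j + b < 2 ^ j := by
  refine ⟨2 * (2 * (a + b + 1)), by omega, ?_⟩
  have h : 2 * (a + b + 1) < 2 ^ (2 * (a + b + 1)) := Nat.lt_two_pow_self
  rw [two_mul (2 * (a + b + 1)), pow_add]
  nlinarith [Nat.zero_le a, Nat.zero_le b]

theorem hammingDist_not {M : ℕ} (x y : Fin M → Bool) :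
    hammingDist (fun i => !(x i)) y + hammingDist x y = M := by
  simp only [hammingDist, Finset.card_filter, ← Finset.sum_add_distrib]
  rw [Finset.sum_congr rfl (g := fun _ => 1)
    (fun i _ => by cases x i <;> cases y i <;> simp)]
  simp

theorem majXor_interleave {M : ℕ} (x y : Fin M → Bool) :
    majXor (2 * M) (interleave (2 * M) (getBit x) (getBit y)) =
      decide (M < 2 * hammingDist x y) := by
  have h : ((Finset.range M).filter fun t =>
      xorPair (interleave (2 * M) (getBit x) (getBit y)) t = true).card = hammingDist x y := by
    rw [Finset.card_filter, Finset.sum_range, hammingDist, Finset.card_filter]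
    refine Finset.sum_congr rfl fun i _ => ?_
    rw [xorPair_interleave _ _ (by omega)]
    simp [getBit]
  rw [majXor, show 2 * M / 2 = M by omega, h]

/-- A square of side `2 ^ (M - r)` with all distances at least `M / 2` forces `r` to be linear in
`M`, since `(32 / 25) ^ 3 > 2`. -/
theorem le_of_hammingDist_ge {d r : ℕ} (hr : r ≤ 2 * d) (A B : Finset (Fin (2 * d) → Bool))
    (hA : A.card = 2 ^ (2 * d - r)) (hB : B.card = 2 ^ (2 * d - r))
    (h : ∀ a ∈ A, ∀ b ∈ B, d ≤ hammingDist a b) : 2 * d ≤ 6 * r := by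
  have h1 := card_mul_card_le_of_hammingDist_ge d A B h
  rw [hA, hB] at h1
  have h2 : (32 : ℝ) ^ (2 * d) ≤ 25 ^ (2 * d) * 2 ^ (2 * r) := by
    calc (32 : ℝ) ^ (2 * d) = 2 ^ (2 * d) * 2 ^ (2 * d) * 4 ^ d * 4 ^ (2 * d) := by
          rw [show (4 : ℝ) ^ d = 2 ^ (2 * d) by rw [pow_mul]; norm_num]
          rw [← mul_pow, ← mul_pow, ← mul_pow]; norm_num
      _ = ((2 : ℝ) ^ (2 * d - r) * 2 ^ (2 * d - r) * 4 ^ d * 4 ^ (2 * d)) * 2 ^ (2 * r) := by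
          have : (2 : ℝ) ^ (2 * d) = 2 ^ (2 * d - r) * 2 ^ r := by
            rw [← pow_add]; congr 1; omega
          rw [this, two_mul r, pow_add]; ring
      _ ≤ _ := by
          gcongr
          exact_mod_cast h1
  have h3 : (2 : ℝ) ^ (2 * d) ≤ 2 ^ (6 * r) := by
    have h4 : (2 * 25 ^ 3 : ℝ) ^ (2 * d) ≤ (25 ^ 3) ^ (2 * d) * 2 ^ (6 * r) := by
      calc (2 * 25 ^ 3 : ℝ) ^ (2 * d) ≤ (32 ^ 3) ^ (2 * d) := by gcongr; norm_num
        _ = (32 ^ (2 * d)) ^ 3 := by rw [← pow_mul, ← pow_mul, mul_comm]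
        _ ≤ (25 ^ (2 * d) * 2 ^ (2 * r)) ^ 3 := by gcongr
        _ = _ := by rw [mul_pow, ← pow_mul, ← pow_mul, ← pow_mul]; ring_nf
    rw [mul_pow, mul_comm] at h4
    exact le_of_mul_le_mul_left h4 (by positivity)
  exact (pow_le_pow_iff_right₀ (by norm_num : (1 : ℝ) < 2)).mp h3

theorem majXor_notMem_LDL : majXor ∉ LDL := by
  refine notMem_LDL_of_no_rectangle fun e => ?_
  obtain ⟨j, hj1, hj⟩ := exists_linear_lt_two_pow (6 * e) (6 * e + 6)
  obtain ⟨j, rfl⟩ : ∃ i, j = i + 1 := ⟨j - 1, by omega⟩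
  set d := 2 ^ j with hd
  have hd2 : 2 ^ (j + 1) = 2 * d := by rw [pow_succ]; ring
  have hn : 2 * (2 * d) = 2 ^ (j + 2) := by rw [pow_succ, hd2]; ring
  rw [hd2] at hj
  have hlt : 6 * ((j + 2) * e + 1) < 2 * d := by nlinarith
  refine ⟨2 * (2 * d), 2 * d, (j + 2) * e + 1, by omega, by omega, ?_, ?_⟩
  · rw [hn, ← pow_mul]
    exact Nat.pow_lt_pow_right (by norm_num) (by omega)
  · intro A B c hA hB h
    simp only [majXor_interleave] at h
    cases c with
    | true =>
      have := le_of_hammingDist_ge (by omega) A B hA hB fun a ha b hb => by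
        have := h a ha b hb
        simp only [decide_eq_true_eq] at this
        omega
      omega
    | false =>
      have hinj : Function.Injective fun (x : Fin (2 * d) → Bool) i => !(x i) := by
        intro x y hxy
        funext i
        simpa using congrFun hxy i
      have := le_of_hammingDist_ge (by omega)
        (A.image fun (x : Fin (2 * d) → Bool) i => !(x i)) B
        (by rw [Finset.card_image_of_injective _ hinj, hA]) hB fun a' ha' b hb => by
          obtain ⟨a, ha, rfl⟩ := Finset.mem_image.mp ha'
          have h1 := h a ha b hb
          have h2 := hammingDist_not a b
          simp only [decide_eq_false_iff_not] at h1
          omega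
      omega

/-! ### Fourier analysis on the cube -/

theorem sum_pi_prod {ι κ : Type*} [Fintype ι] [DecidableEq ι] [Fintype κ] (f : ι → κ → ℝ) :
    ∑ x : ι → κ, ∏ i, f i (x i) = ∏ i, ∑ a, f i a := by
  rw [Finset.prod_univ_sum, Fintype.piFinset_univ]

theorem chi_eq_prod {n : ℕ} (S : Finset (Fin n)) (x : Fin n → Bool) :
    chi S x = ∏ i, if i ∈ S then (if x i then -1 else 1) else 1 := by
  rw [chi, ← Finset.prod_pow_eq_pow_sum, Finset.prod_ite_mem, Finset.univ_inter]
  exact Finset.prod_congr rfl fun i _ => by cases x i <;> simp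

theorem chi_empty {n : ℕ} (x : Fin n → Bool) : chi ∅ x = 1 := by simp [chi]

theorem chi_mul_chi {n : ℕ} (S T : Finset (Fin n)) (x : Fin n → Bool) :
    chi S x * chi T x = chi (symmDiff S T) x := by
  simp only [chi_eq_prod, ← Finset.prod_mul_distrib]
  refine Finset.prod_congr rfl fun i _ => ?_
  by_cases h1 : i ∈ S <;> by_cases h2 : i ∈ T <;> cases x i <;>
    simp [h1, h2, Finset.mem_symmDiff]

theorem sum_chi_of_nonempty {n : ℕ} {S : Finset (Fin n)} (hS : S.Nonempty) :
    ∑ x : Fin n → Bool, chi S x = 0 := by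
  obtain ⟨i, hi⟩ := hS
  simp only [chi_eq_prod]
  rw [sum_pi_prod fun i (b : Bool) => if i ∈ S then (if b then (-1 : ℝ) else 1) else 1]
  exact Finset.prod_eq_zero (Finset.mem_univ i) (by simp [hi])

/-- The Fourier inversion formula. -/
theorem sum_fourierCoeffBool_mul_chi {n : ℕ} (f : (Fin n → Bool) → Bool) (x : Fin n → Bool) :
    ∑ S, fourierCoeffBool f S * chi S x = bit (f x) := by
  have key : ∀ y : Fin n → Bool, ∑ S, chi S y * chi S x = if y = x then (2 : ℝ) ^ n else 0 := by
    intro y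
    have h1 : ∀ S : Finset (Fin n), chi S y * chi S x =
        ∏ i ∈ S, (if y i then (-1 : ℝ) else 1) * (if x i then -1 else 1) := by
      intro S
      rw [chi_eq_prod, chi_eq_prod, Finset.prod_ite_mem, Finset.prod_ite_mem, Finset.univ_inter,
        ← Finset.prod_mul_distrib]
    rw [Finset.sum_congr rfl fun S _ => h1 S, ← Finset.powerset_univ, ← Finset.prod_one_add]
    split_ifs with h
    · subst h
      rw [Finset.prod_congr rfl (g := fun _ => (2 : ℝ))
        (fun i _ => by cases y i <;> norm_num)]
      simp
    · obtain ⟨i, hi⟩ := Function.ne_iff.mp h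
      refine Finset.prod_eq_zero (Finset.mem_univ i) ?_
      cases hx : x i <;> cases hy : y i <;> simp_all
  simp only [fourierCoeffBool, Finset.mul_sum, Finset.sum_mul]
  rw [Finset.sum_comm]
  have h2 : ∀ y : Fin n → Bool, ∑ S, 1 / 2 ^ n * (bit (f y) * chi S y) * chi S x =
      if y = x then bit (f y) else 0 := by
    intro y
    rw [Finset.sum_congr rfl (g := fun S => 1 / 2 ^ n * bit (f y) * (chi S y * chi S x))
      (fun S _ => by ring), ← Finset.mul_sum, key]
    split_ifs
    · field_simp
    · simp
  rw [Finset.sum_congr rfl fun y _ => h2 y]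
  simp

/-- The spectral norm of a real function on the cube: the sum of the absolute values of its Fourier
coefficients. -/
noncomputable def specNorm {n : ℕ} (g : (Fin n → Bool) → ℝ) : ℝ :=
  ∑ S : Finset (Fin n), |1 / 2 ^ n * ∑ x, g x * chi S x|

theorem specNorm_add_le {n : ℕ} (g h : (Fin n → Bool) → ℝ) :
    specNorm (fun x => g x + h x) ≤ specNorm g + specNorm h := by
  simp only [specNorm, ← Finset.sum_add_distrib]
  refine Finset.sum_le_sum fun S _ => ?_
  simp only [add_mul, Finset.sum_add_distrib, mul_add]
  exact abs_add_le _ _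

theorem specNorm_smul {n : ℕ} (c : ℝ) (g : (Fin n → Bool) → ℝ) :
    specNorm (fun x => c * g x) = |c| * specNorm g := by
  simp only [specNorm, Finset.mul_sum, ← abs_mul]
  refine Finset.sum_congr rfl fun S _ => ?_
  congr 1
  exact Finset.sum_congr rfl fun x _ => by ring

theorem specNorm_zero {n : ℕ} : specNorm (fun _ : Fin n → Bool => (0 : ℝ)) = 0 := by
  simp [specNorm]

theorem specNorm_one {n : ℕ} : specNorm (fun _ : Fin n → Bool => (1 : ℝ)) = 1 := by
  rw [specNorm, Finset.sum_eq_single ∅]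
  · simp [chi_empty]
  · intro S _ hS
    simp [sum_chi_of_nonempty (Finset.nonempty_iff_ne_empty.mpr hS)]
  · simp

theorem specNorm_nonneg {n : ℕ} (g : (Fin n → Bool) → ℝ) : 0 ≤ specNorm g :=
  Finset.sum_nonneg fun _ _ => abs_nonneg _

/-- Multiplication by a character permutes the Fourier coefficients. -/
theorem specNorm_mul_chi {n : ℕ} (g : (Fin n → Bool) → ℝ) (T : Finset (Fin n)) :
    specNorm (fun x => g x * chi T x) = specNorm g := by
  simp only [specNorm, mul_assoc, chi_mul_chi]
  refine Fintype.sum_equiv (Function.Involutive.toPerm (fun S => symmDiff T S) fun S => ?_) _ _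
    fun S => rfl
  exact symmDiff_symmDiff_cancel_left T S

theorem specNorm_mul_half_le {n : ℕ} (g : (Fin n → Bool) → ℝ) (T : Finset (Fin n)) {c : ℝ}
    (hc : |c| ≤ 1) : specNorm (fun x => g x * ((1 + c * chi T x) / 2)) ≤ specNorm g := by
  have h : (fun x => g x * ((1 + c * chi T x) / 2)) =
      fun x => 1 / 2 * g x + c / 2 * (g x * chi T x) := by
    funext x; ring
  rw [h]
  refine (specNorm_add_le _ _).trans ?_
  rw [specNorm_smul, specNorm_smul, specNorm_mul_chi, abs_div, abs_div, abs_one,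
    abs_of_pos (two_pos : (0 : ℝ) < 2)]
  nlinarith [specNorm_nonneg g]

theorem specNorm_sum_le {n : ℕ} {V : Type*} (s : Finset V) (g : V → (Fin n → Bool) → ℝ) :
    specNorm (fun x => ∑ v ∈ s, g v x) ≤ ∑ v ∈ s, specNorm (g v) := by
  classical
  induction s using Finset.induction_on with
  | empty => simp [specNorm_zero]
  | insert v s hv ih =>
    simp only [Finset.sum_insert hv]
    exact (specNorm_add_le _ _).trans (by gcongr)

/-- A conjunction of parity constraints has spectral norm at most `1`. -/
theorem specNorm_prod_half_le {n : ℕ} {V : Type*} (s : Finset V) (T : V → Finset (Fin n))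
    (c : V → ℝ) (hc : ∀ v, |c v| ≤ 1) :
    specNorm (fun x => ∏ v ∈ s, (1 + c v * chi (T v) x) / 2) ≤ 1 := by
  classical
  induction s using Finset.induction_on with
  | empty => simp [specNorm_one]
  | insert v s hv ih =>
    simp only [Finset.prod_insert hv]
    simp only [mul_comm ((1 + c v * chi (T v) _) / 2)]
    exact (specNorm_mul_half_le _ _ (hc v)).trans ih

/-! ### Finner's inequality for functions sharing each coordinate at most pairwise -/

theorem sq_half_add_le_prod {V : Type*} [DecidableEq V] (s : Finset V) (p q : V → ℝ)
    (hp : ∀ v, 0 ≤ p v) (hq : ∀ v, 0 ≤ q v) (hs : (s.filter fun v => p v ≠ q v).card ≤ 2)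
    {a b : ℝ} (ha : a ^ 2 ≤ ∏ v ∈ s, p v) (hb : b ^ 2 ≤ ∏ v ∈ s, q v) :
    ((a + b) / 2) ^ 2 ≤ ∏ v ∈ s, (p v + q v) / 2 := by
  have split : ∀ g : V → ℝ, ∏ v ∈ s, g v =
      (∏ v ∈ s with p v ≠ q v, g v) * ∏ v ∈ s with ¬ p v ≠ q v, g v := fun g =>
    (Finset.prod_filter_mul_prod_filter_not s _ g).symm
  rw [split] at ha hb ⊢
  have e1 : ∏ v ∈ s with ¬ p v ≠ q v, q v = ∏ v ∈ s with ¬ p v ≠ q v, p v :=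
    Finset.prod_congr rfl fun v hv => (not_not.mp (Finset.mem_filter.mp hv).2).symm
  have e2 : ∏ v ∈ s with ¬ p v ≠ q v, (p v + q v) / 2 = ∏ v ∈ s with ¬ p v ≠ q v, p v :=
    Finset.prod_congr rfl fun v hv => by
      rw [not_not.mp (Finset.mem_filter.mp hv).2]; ring
  rw [e1] at hb
  rw [e2]
  have hC : 0 ≤ ∏ v ∈ s with ¬ p v ≠ q v, p v := Finset.prod_nonneg fun v _ => hp v
  generalize ∏ v ∈ s with ¬ p v ≠ q v, p v = C at *
  generalize s.filter (fun v => p v ≠ q v) = W at *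
  obtain h | h | h : W.card = 0 ∨ W.card = 1 ∨ W.card = 2 := by omega
  · rw [Finset.card_eq_zero] at h
    subst h
    simp only [Finset.prod_empty, one_mul] at *
    nlinarith [sq_nonneg (a - b)]
  · obtain ⟨u, rfl⟩ := Finset.card_eq_one.mp h
    simp only [Finset.prod_singleton] at *
    nlinarith [sq_nonneg (a - b)]
  · obtain ⟨u, v, huv, rfl⟩ := Finset.card_eq_two.mp h
    simp only [Finset.prod_pair huv] at *
    have h1 : 0 ≤ C * (p u * q v + q u * p v) := by
      have := hp u; have := hp v; have := hq u; have := hq v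
      positivity
    have h2 : (2 * (a * b)) ^ 2 ≤ (C * (p u * q v + q u * p v)) ^ 2 := by
      have h3 := mul_le_mul ha hb (sq_nonneg b) ((sq_nonneg a).trans ha)
      have h4 : 0 ≤ C ^ 2 * (p u * q v - q u * p v) ^ 2 := by positivity
      nlinarith
    have h5 : 2 * (a * b) ≤ C * (p u * q v + q u * p v) := le_of_abs_le (abs_le_of_sq_le_sq h2 h1)
    nlinarith

/-- If no coordinate of the cube is relevant to more than two of the functions `g v`, then
`(E ∏ g v) ^ 2 ≤ ∏ E (g v) ^ 2`. -/
theorem sq_avg_prod_le {V : Type*} [DecidableEq V] (s : Finset V) {M : ℕ} :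
    ∀ (F : V → Fin M → Prop) (g : V → (Fin M → Bool) → ℝ),
      (∀ v x y, (∀ i, F v i → x i = y i) → g v x = g v y) →
      (∀ i, ∀ W ⊆ s, (∀ v ∈ W, F v i) → W.card ≤ 2) →
      ((∑ x, ∏ v ∈ s, g v x) / 2 ^ M) ^ 2 ≤ ∏ v ∈ s, (∑ x, g v x ^ 2) / 2 ^ M := by
  induction M with
  | zero =>
    intro F g _ _
    simp [Finset.prod_pow]
  | succ M ih =>
    intro F g hg hF
    have half : ∀ f : (Fin (M + 1) → Bool) → ℝ, (∑ x, f x) / 2 ^ (M + 1) =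
        ((∑ x, f (Fin.cons true x)) / 2 ^ M + (∑ x, f (Fin.cons false x)) / 2 ^ M) / 2 := by
      intro f
      rw [sum_fin_succ_pi, Fintype.sum_bool, pow_succ]
      ring
    have step : ∀ b, ((∑ x, ∏ v ∈ s, g v (Fin.cons b x)) / 2 ^ M) ^ 2 ≤
        ∏ v ∈ s, (∑ x, g v (Fin.cons b x) ^ 2) / 2 ^ M := by
      intro b
      refine ih (fun v i => F v i.succ) (fun v x => g v (Fin.cons b x)) ?_ fun i => hF i.succ
      intro v x y h
      refine hg v _ _ fun i hi => ?_
      cases i using Fin.cases with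
      | zero => simp
      | succ i => simpa using h i hi
    simp only [half]
    refine sq_half_add_le_prod s _ _ (fun v => ?_) (fun v => ?_) ?_ (step true) (step false)
    · positivity
    · positivity
    · refine hF 0 _ (Finset.filter_subset _ _) fun v hv => ?_
      by_contra h0
      refine (Finset.mem_filter.mp hv).2 ?_
      congr 1
      refine Finset.sum_congr rfl fun x _ => ?_
      rw [hg v (Fin.cons true x) (Fin.cons false x) fun i hi => ?_]
      cases i using Fin.cases with
      | zero => exact absurd hi h0
      | succ i => simp

/-! ### The sink function composed with parities -/

/-- In a tournament on `{0, …, N - 1}` encoded by bits at the positions `t = u N + w`, the bits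
relevant to the vertex `v` are those with `u ≠ w` and `v ∈ {u, w}`. (Each pair of vertices is
encoded twice, by `u N + w` and `w N + u`.) -/
def Incident (N v t : ℕ) : Prop := t / N ≠ t % N ∧ (t / N = v ∨ t % N = v)

/-- The vertex `v` is a sink: every relevant bit `u N + w` is `1` if `u = v` (an arc from `w`
to `v`) and `0` if `w = v` (an arc from `u` to `v`). -/
def IsSinkAt (N : ℕ) (z : ℕ → Bool) (v : ℕ) : Prop :=
  ∀ t < N * N, Incident N v t → z t = decide (t / N = v)

open Classical in
/-- The family `SINK ∘ XOR`: is there a sink in the tournament on `⌊√(n / 2)⌋` vertices whose bits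
are the parities of the disjoint pairs of variables? -/
noncomputable def sinkXor : BoolFamily := fun n x =>
  decide (∃ v < Nat.sqrt (n / 2), IsSinkAt (Nat.sqrt (n / 2)) (xorPair x) v)

theorem IsSinkAt.unique {N : ℕ} {z : ℕ → Bool} {u v : ℕ} (hu : u < N) (hv : v < N)
    (h : IsSinkAt N z u) (h' : IsSinkAt N z v) : u = v := by
  by_contra hne
  have hd : (u * N + v) / N = u := by
    rw [mul_comm, Nat.mul_add_div (by omega), Nat.div_eq_of_lt hv, add_zero]
  have hm : (u * N + v) % N = v := by
    rw [mul_comm, Nat.mul_add_mod, Nat.mod_eq_of_lt hv]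
  have hlt : u * N + v < N * N := by nlinarith
  have h1 := h _ hlt ⟨by rw [hd, hm]; exact hne, Or.inl hd⟩
  have h2 := h' _ hlt ⟨by rw [hd, hm]; exact hne, Or.inr hm⟩
  rw [h1, hd] at h2
  simp [hne] at h2

/-- The pair of variables `2t, 2t + 1`. -/
def pairSet (n t : ℕ) : Finset (Fin n) := {j | (j : ℕ) / 2 = t}

theorem sum_pairSet {M : Type*} [AddCommMonoid M] {n t : ℕ} (h : 2 * t + 1 < n) (f : Fin n → M) :
    ∑ j ∈ pairSet n t, f j = f ⟨2 * t, by omega⟩ + f ⟨2 * t + 1, h⟩ := by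
  have hT : pairSet n t = {⟨2 * t, by omega⟩, ⟨2 * t + 1, h⟩} := by
    ext j
    simp only [pairSet, Finset.mem_filter, Finset.mem_univ, true_and, Finset.mem_insert,
      Finset.mem_singleton, Fin.ext_iff]
    omega
  rw [hT, Finset.sum_pair (by simp [Fin.ext_iff])]

theorem chi_pairSet {n : ℕ} (x : Fin n → Bool) {t : ℕ} (h : 2 * t + 1 < n) :
    chi (pairSet n t) x = if xorPair x t then -1 else 1 := by
  have h0 : 2 * t < n := by omega
  rw [chi, sum_pairSet h]
  simp only [xorPair, getBit, h, h0, dif_pos]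
  cases x ⟨2 * t, h0⟩ <;> cases x ⟨2 * t + 1, h⟩ <;> simp

theorem sqrt_half_bound {n t : ℕ} (ht : t < Nat.sqrt (n / 2) * Nat.sqrt (n / 2)) :
    2 * t + 1 < n := by
  have := Nat.sqrt_le (n / 2)
  omega

open Classical in
theorem bit_sinkXor (n : ℕ) (x : Fin n → Bool) :
    bit (sinkXor n x) = ∑ v ∈ Finset.range (Nat.sqrt (n / 2)),
      ∏ t ∈ (Finset.range (Nat.sqrt (n / 2) * Nat.sqrt (n / 2))).filter
          (Incident (Nat.sqrt (n / 2)) v),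
        (1 + (if t / Nat.sqrt (n / 2) = v then -1 else 1) * chi (pairSet n t) x) / 2 := by
  set N := Nat.sqrt (n / 2) with hN
  have hprod : ∀ v, ∏ t ∈ (Finset.range (N * N)).filter (Incident N v),
        (1 + (if t / N = v then -1 else 1) * chi (pairSet n t) x) / 2 =
      if IsSinkAt N (xorPair x) v then 1 else 0 := by
    intro v
    split_ifs with h
    · refine Finset.prod_eq_one fun t ht => ?_
      rw [Finset.mem_filter, Finset.mem_range] at ht
      rw [chi_pairSet x (sqrt_half_bound ht.1), h t ht.1 ht.2]
      by_cases h1 : t / N = v <;> norm_num [h1]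
    · simp only [IsSinkAt, not_forall] at h
      obtain ⟨t, ht, hi, hz⟩ := h
      refine Finset.prod_eq_zero
        (Finset.mem_filter.mpr ⟨Finset.mem_range.mpr ht, hi⟩) ?_
      rw [chi_pairSet x (sqrt_half_bound ht)]
      by_cases h1 : t / N = v <;> cases h2 : xorPair x t <;> simp_all
  simp only [hprod, sinkXor, bit, decide_eq_true_eq, ← hN]
  split_ifs with h
  · obtain ⟨v, hv, hs⟩ := h
    rw [Finset.sum_eq_single v]
    · simp [hs]
    · intro u hu huv
      rw [if_neg fun h => huv (h.unique (Finset.mem_range.mp hu) hv hs)]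
    · intro h1; exact absurd (Finset.mem_range.mpr hv) h1
  · refine (Finset.sum_eq_zero fun v hv => ?_).symm
    exact if_neg fun h1 => h ⟨v, Finset.mem_range.mp hv, h1⟩

theorem sinkXor_mem_PL1 : sinkXor ∈ PL1 := by
  classical
  refine ⟨Polynomial.X, fun n => ?_⟩
  have h1 : ∑ S : Finset (Fin n), |fourierCoeffBool (sinkXor n) S| =
      specNorm fun x => bit (sinkXor n x) := rfl
  rw [h1, Polynomial.eval_X, funext (bit_sinkXor n)]
  refine (specNorm_sum_le _ _).trans ?_
  refine (Finset.sum_le_card_nsmul _ _ 1 fun v _ => ?_).trans ?_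
  · exact specNorm_prod_half_le _ _ _ fun t => by split_ifs <;> simp
  · rw [Finset.card_range, nsmul_eq_mul, mul_one]
    exact_mod_cast (Nat.sqrt_le_self _).trans (Nat.div_le_self _ _)

/-- The strings that agree with an element of `A` on the bits relevant to the vertex `v`. -/
noncomputable def hull (N : ℕ) {M : ℕ} (A : Finset (Fin M → Bool)) (v : ℕ) :
    Finset (Fin M → Bool) :=
  open Classical in {x | ∃ a ∈ A, ∀ i : Fin M, Incident N v i → x i = a i}

/-- The density of a set is at most the geometric mean of the squared densities of its hulls. -/
theorem sq_card_le_prod_hull (N : ℕ) {M : ℕ} (A : Finset (Fin M → Bool)) :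
    ((A.card : ℝ) / 2 ^ M) ^ 2 ≤ ∏ v ∈ Finset.range N, ((hull N A v).card : ℝ) / 2 ^ M := by
  classical
  have key := sq_avg_prod_le (Finset.range N) (M := M) (fun v i => Incident N v i)
    (fun v x => if x ∈ hull N A v then 1 else 0)
    (fun v x y h => by
      have : x ∈ hull N A v ↔ y ∈ hull N A v := by
        simp only [hull, Finset.mem_filter, Finset.mem_univ, true_and]
        refine exists_congr fun a => and_congr_right fun _ => forall_congr' fun i =>
          imp_congr_right fun hi => ?_
        rw [h i hi]
      simp only [this])
    (fun i W _ hW => by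
      refine (Finset.card_le_card (t := {(i : ℕ) / N, (i : ℕ) % N}) fun v hv => ?_).trans
        Finset.card_le_two
      rcases (hW v hv).2 with h | h <;> simp [h])
  have e : ∀ v, ∑ x, (if x ∈ hull N A v then (1 : ℝ) else 0) ^ 2 = (hull N A v).card := by
    intro v; simp
  simp only [e] at key
  refine le_trans ?_ key
  gcongr
  have : (A.card : ℝ) = ∑ x, if x ∈ A then (1 : ℝ) else 0 := by simp
  rw [this]
  refine Finset.sum_le_sum fun x _ => ?_
  split_ifs with h
  · rw [Finset.prod_eq_one fun v _ => ?_]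
    rw [if_pos]
    simp only [hull, Finset.mem_filter, Finset.mem_univ, true_and]
    exact ⟨x, h, fun _ _ => rfl⟩
  · exact Finset.prod_nonneg fun v _ => by split_ifs <;> simp

/-- If no pair in `A × B` has a sink at `v`, then the hull of `A` and the translated hull of `B` are
disjoint. -/
theorem card_hull_add_card_hull_le {N M : ℕ} (A B : Finset (Fin M → Bool)) (v : ℕ)
    (h : ∀ a ∈ A, ∀ b ∈ B, ¬ ∀ i : Fin M, Incident N v i → xor (a i) (b i) = decide (i / N = v)) :
    (hull N A v).card + (hull N B v).card ≤ 2 ^ M := by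
  classical
  set σ : (Fin M → Bool) → (Fin M → Bool) := fun x i => xor (x i) (decide ((i : ℕ) / N = v))
  have hσ : Function.Injective σ := by
    intro x y hxy
    funext i
    simpa [σ] using congrFun hxy i
  have hdisj : Disjoint (hull N A v) ((hull N B v).image σ) := by
    rw [Finset.disjoint_left]
    intro x hx hx'
    obtain ⟨y, hy, rfl⟩ := Finset.mem_image.mp hx'
    simp only [hull, Finset.mem_filter, Finset.mem_univ, true_and] at hx hy
    obtain ⟨a, ha, hxa⟩ := hx
    obtain ⟨b, hb, hyb⟩ := hy
    refine h a ha b hb fun i hi => ?_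
    rw [← hxa i hi, ← hyb i hi]
    simp only [σ]
    cases y i <;> simp
  rw [← Finset.card_image_of_injective (hull N B v) hσ, ← Finset.card_union_of_disjoint hdisj]
  refine (Finset.card_le_univ _).trans ?_
  simp

theorem sinkXor_interleave {N : ℕ} (x y : Fin (N * N) → Bool) :
    sinkXor (2 * (N * N)) (interleave (2 * (N * N)) (getBit x) (getBit y)) = true ↔
      ∃ v < N, ∀ i : Fin (N * N), Incident N v i → xor (x i) (y i) = decide ((i : ℕ) / N = v) := by
  have hs : Nat.sqrt (2 * (N * N) / 2) = N := by
    rw [Nat.mul_div_cancel_left _ two_pos, Nat.sqrt_eq]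
  simp only [sinkXor, decide_eq_true_eq]
  rw [hs]
  simp only [IsSinkAt]
  refine exists_congr fun v => and_congr_right fun _ => ?_
  constructor
  · intro h i hi
    have := h i i.2 hi
    rwa [xorPair_interleave _ _ (by omega), getBit, getBit, dif_pos i.2, dif_pos i.2] at this
  · intro h t ht hi
    rw [xorPair_interleave _ _ (by omega), getBit, getBit, dif_pos ht, dif_pos ht]
    exact h ⟨t, ht⟩ hi

theorem card_agree_mul {M : ℕ} (F : Finset (Fin M)) (c : Fin M → Bool) :
    (Finset.univ.filter fun x : Fin M → Bool => ∀ i ∈ F, x i = c i).card * 2 ^ F.card = 2 ^ M := by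
  have h : (Finset.univ.filter fun x : Fin M → Bool => ∀ i ∈ F, x i = c i) =
      Fintype.piFinset fun i => if i ∈ F then {c i} else Finset.univ := by
    ext x
    simp only [Finset.mem_filter, Finset.mem_univ, true_and, Fintype.mem_piFinset]
    refine forall_congr' fun i => ?_
    by_cases hi : i ∈ F <;> simp [hi]
  rw [h, Fintype.card_piFinset]
  have h2 : ∀ i, (if i ∈ F then ({c i} : Finset Bool) else Finset.univ).card =
      if i ∈ F then 1 else 2 := by
    intro i; split_ifs <;> simp
  have h3 : (2 : ℕ) ^ F.card = ∏ i, if i ∈ F then 2 else 1 := by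
    rw [Finset.prod_ite_mem, Finset.univ_inter, Finset.prod_const]
  rw [Finset.prod_congr rfl fun i _ => h2 i, h3, ← Finset.prod_mul_distrib,
    Finset.prod_congr rfl (g := fun _ => 2) fun i _ => by split_ifs <;> rfl]
  simp

/-- Every row of the two-party matrix of the sink function has few ones. -/
theorem card_le_of_sink {N : ℕ} (a : Fin (N * N) → Bool) (B : Finset (Fin (N * N) → Bool))
    (h : ∀ b ∈ B, ∃ v < N, ∀ i : Fin (N * N), Incident N v i →
      xor (a i) (b i) = decide ((i : ℕ) / N = v)) :
    B.card * 2 ^ (N - 1) ≤ N * 2 ^ (N * N) := by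
  classical
  -- the bits `v N + u` with `u ≠ v`
  let F : Fin N → Finset (Fin (N * N)) := fun v =>
    (Finset.univ.erase v).image fun u => finProdFinEquiv (v, u)
  have hF : ∀ v, (F v).card = N - 1 := by
    intro v
    rw [Finset.card_image_of_injective _ fun u w huw => by simpa using huw,
      Finset.card_erase_of_mem (Finset.mem_univ _), Finset.card_univ, Fintype.card_fin]
  let D : Fin N → Finset (Fin (N * N) → Bool) := fun v =>
    Finset.univ.filter fun x => ∀ i ∈ F v, x i = !(a i)
  have hsub : B ⊆ Finset.univ.biUnion D := by
    intro b hb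
    obtain ⟨v, hv, hs⟩ := h b hb
    refine Finset.mem_biUnion.mpr ⟨⟨v, hv⟩, Finset.mem_univ _, ?_⟩
    refine Finset.mem_filter.mpr ⟨Finset.mem_univ _, fun i hi => ?_⟩
    obtain ⟨u, hu, rfl⟩ := Finset.mem_image.mp hi
    have hne : u ≠ ⟨v, hv⟩ := Finset.ne_of_mem_erase hu
    have hd : ((finProdFinEquiv (⟨v, hv⟩, u) : Fin (N * N)) : ℕ) / N = v := by
      simp only [finProdFinEquiv_apply_val]
      rw [Nat.add_mul_div_left _ _ (by omega), Nat.div_eq_of_lt u.2, zero_add]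
    have hm : ((finProdFinEquiv (⟨v, hv⟩, u) : Fin (N * N)) : ℕ) % N = u := by
      simp only [finProdFinEquiv_apply_val]
      rw [Nat.add_mul_mod_self_left, Nat.mod_eq_of_lt u.2]
    have := hs (finProdFinEquiv (⟨v, hv⟩, u))
      ⟨by rw [hd, hm]; exact fun e => hne (Fin.ext e.symm), Or.inl hd⟩
    rw [hd] at this
    revert this
    cases a (finProdFinEquiv (⟨v, hv⟩, u)) <;> simp
  calc B.card * 2 ^ (N - 1) ≤ (∑ v, (D v).card) * 2 ^ (N - 1) := by
        gcongr
        exact (Finset.card_le_card hsub).trans Finset.card_biUnion_le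
    _ = ∑ v, (D v).card * 2 ^ (F v).card := by
        rw [Finset.sum_mul]; exact Finset.sum_congr rfl fun v _ => by rw [hF]
    _ = N * 2 ^ (N * N) := by
        rw [Finset.sum_congr rfl fun v _ => card_agree_mul (F v) fun i => !(a i)]
        simp

theorem sinkXor_notMem_LDL : sinkXor ∉ LDL := by
  refine notMem_LDL_of_no_rectangle fun e => ?_
  obtain ⟨j, hj1, hj⟩ := exists_linear_lt_two_pow (4 * e + 1) (2 * e + 4)
  set N := 2 ^ j with hN
  set r := (2 * j + 1) * e + 1 with hr
  have hrN : 2 * r + j + 1 < N := by rw [hr]; nlinarith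
  have hNN : N ≤ N * N := Nat.le_mul_self N
  refine ⟨2 * (N * N), N * N, r, by omega, by omega, ?_, fun A B c hA hB h => ?_⟩
  · have : 2 * (N * N) = 2 ^ (2 * j + 1) := by
      rw [hN, pow_succ, ← pow_add, ← two_mul, mul_comm]
    rw [this, ← pow_mul]
    exact Nat.pow_lt_pow_right (by norm_num) (by omega)
  have hpow : (2 : ℕ) ^ (N * N) = 2 ^ (N * N - r) * 2 ^ r :=
    (pow_sub_mul_pow 2 (by omega)).symm
  cases c with
  | true =>
    obtain ⟨a, ha⟩ := Finset.card_pos.mp (hA ▸ (by positivity) : 0 < A.card)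
    have h1 := card_le_of_sink a B fun b hb => (sinkXor_interleave a b).mp (h a ha b hb)
    rw [hB, hpow, mul_left_comm] at h1
    have h2 := Nat.le_of_mul_le_mul_left h1 (by positivity)
    rw [hN, ← pow_add] at h2
    have := (Nat.pow_le_pow_iff_right (by norm_num : 1 < 2)).mp h2
    omega
  | false =>
    have hd : ∀ C : Finset (Fin (N * N) → Bool), C.card = 2 ^ (N * N - r) →
        (C.card : ℝ) / 2 ^ (N * N) = 1 / 2 ^ r := by
      intro C hC
      have : (2 : ℝ) ^ (N * N) = 2 ^ (N * N - r) * 2 ^ r := by exact_mod_cast hpow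
      rw [hC, this]
      push_cast
      field_simp
    have hle : ∀ v ∈ Finset.range N,
        ((hull N A v).card : ℝ) / 2 ^ (N * N) * ((hull N B v).card / 2 ^ (N * N)) ≤ 1 / 4 := by
      intro v hv
      have h1 := card_hull_add_card_hull_le (N := N) A B v fun a ha b hb hs => by
        have h2 := (sinkXor_interleave a b).mpr ⟨v, Finset.mem_range.mp hv, hs⟩
        rw [h a ha b hb] at h2
        exact Bool.false_ne_true h2
      have h2 : ((hull N A v).card : ℝ) / 2 ^ (N * N) + (hull N B v).card / 2 ^ (N * N) ≤ 1 := by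
        rw [← add_div, div_le_one (by positivity)]
        exact_mod_cast h1
      nlinarith [sq_nonneg (((hull N A v).card : ℝ) / 2 ^ (N * N) -
        (hull N B v).card / 2 ^ (N * N)), (by positivity : 0 ≤ ((hull N A v).card : ℝ) /
        2 ^ (N * N)), (by positivity : 0 ≤ ((hull N B v).card : ℝ) / 2 ^ (N * N))]
    have h1 := mul_le_mul (sq_card_le_prod_hull N A) (sq_card_le_prod_hull N B) (sq_nonneg _)
      (Finset.prod_nonneg fun v _ => by positivity)
    rw [hd A hA, hd B hB, ← Finset.prod_mul_distrib] at h1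
    have h2 := h1.trans (Finset.prod_le_prod (fun v _ => by positivity) hle)
    rw [Finset.prod_const, Finset.card_range] at h2
    have h3 : (2 : ℝ) ^ (2 * N) ≤ 2 ^ (4 * r) := by
      have e1 : (1 / 2 ^ r : ℝ) ^ 2 * (1 / 2 ^ r) ^ 2 = 1 / 2 ^ (4 * r) := by
        rw [← pow_add, one_div_pow, ← pow_mul]; congr 2; ring
      have e2 : (1 / 4 : ℝ) ^ N = 1 / 2 ^ (2 * N) := by
        rw [one_div_pow, pow_mul]; norm_num
      rw [e1, e2] at h2
      exact (one_div_le_one_div (by positivity) (by positivity)).mp h2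
    have := (pow_le_pow_iff_right₀ (by norm_num : (1 : ℝ) < 2)).mp h3
    omega

/-! ### Discrepancy -/

/-- The signed matrix `φ` has discrepancy at most `ε`: it nearly annihilates every product of a
function of the row and a function of the column, both bounded by `1`. -/
def DiscLE {X Y : Type*} [Fintype X] [Fintype Y] (φ : X → Y → ℝ) (ε : ℝ) : Prop :=
  ∀ (A : X → ℝ) (B : Y → ℝ), (∀ x, |A x| ≤ 1) → (∀ y, |B y| ≤ 1) →
    |∑ x, ∑ y, φ x y * (A x * B y)| ≤ ε

section
variable {X Y : Type*} [Fintype X] [Fintype Y]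

theorem DiscLE.mono {φ : X → Y → ℝ} {ε ε' : ℝ} (h : DiscLE φ ε) (hε : ε ≤ ε') : DiscLE φ ε' :=
  fun A B hA hB => (h A B hA hB).trans hε

theorem DiscLE.add {φ ψ : X → Y → ℝ} {ε ε' : ℝ} (h : DiscLE φ ε) (h' : DiscLE ψ ε') :
    DiscLE (fun x y => φ x y + ψ x y) (ε + ε') := by
  intro A B hA hB
  simp only [add_mul, Finset.sum_add_distrib]
  exact (abs_add_le _ _).trans (add_le_add (h A B hA hB) (h' A B hA hB))

theorem DiscLE.smul {φ : X → Y → ℝ} {ε : ℝ} (h : DiscLE φ ε) (c : ℝ) :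
    DiscLE (fun x y => c * φ x y) (|c| * ε) := by
  intro A B hA hB
  simp only [mul_assoc c, ← Finset.mul_sum, abs_mul c]
  exact mul_le_mul_of_nonneg_left (h A B hA hB) (abs_nonneg c)

theorem DiscLE.sum {ι : Type*} (s : Finset ι) {φ : ι → X → Y → ℝ} {ε : ι → ℝ}
    (h : ∀ i ∈ s, DiscLE (φ i) (ε i)) : DiscLE (fun x y => ∑ i ∈ s, φ i x y) (∑ i ∈ s, ε i) := by
  classical
  induction s using Finset.induction_on with
  | empty => intro A B _ _; simp
  | insert i s hi ih =>
    simp only [Finset.sum_insert hi]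
    exact (h i (Finset.mem_insert_self i s)).add
      (ih fun j hj => h j (Finset.mem_insert_of_mem hj))

/-- A matrix of nonnegative entries has discrepancy at most the sum of its entries. -/
theorem discLE_of_nonneg {φ : X → Y → ℝ} (h : ∀ x y, 0 ≤ φ x y) {M : ℝ}
    (hM : ∑ x, ∑ y, φ x y ≤ M) : DiscLE φ M := by
  intro A B hA hB
  refine (Finset.abs_sum_le_sum_abs _ _).trans (le_trans ?_ hM)
  refine Finset.sum_le_sum fun x _ => (Finset.abs_sum_le_sum_abs _ _).trans ?_
  refine Finset.sum_le_sum fun y _ => ?_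
  rw [abs_mul, abs_mul, abs_of_nonneg (h x y)]
  exact mul_le_of_le_one_right (h x y) (mul_le_one₀ (hA x) (abs_nonneg _) (hB y))

theorem sum_comm_pairs {Z W : Type*} [Fintype Z] [Fintype W] (f : X → Y → Z → W → ℝ) :
    ∑ x, ∑ y, ∑ z, ∑ w, f x y z w = ∑ z, ∑ w, ∑ x, ∑ y, f x y z w := by
  have h := Finset.sum_comm (s := (Finset.univ : Finset (X × Y)))
    (t := (Finset.univ : Finset (Z × W))) (f := fun p q => f p.1 p.2 q.1 q.2)
  simpa only [Fintype.sum_prod_type] using h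

theorem sum_sum_fin_succ {k : ℕ} (F : (Fin (k + 1) → X) → (Fin (k + 1) → Y) → ℝ) :
    ∑ x, ∑ y, F x y = ∑ x₀, ∑ y₀, ∑ x : Fin k → X, ∑ y : Fin k → Y,
      F (Fin.cons x₀ x) (Fin.cons y₀ y) := by
  rw [sum_fin_succ_pi]
  refine Finset.sum_congr rfl fun x₀ _ => ?_
  rw [Finset.sum_congr rfl fun x _ => sum_fin_succ_pi (F (Fin.cons x₀ x))]
  exact Finset.sum_comm

/-- The tensor product of a matrix on first letters and a matrix on the remaining letters. -/
def tens {k : ℕ} (φ : X → Y → ℝ) (ψ : (Fin k → X) → (Fin k → Y) → ℝ)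
    (x : Fin (k + 1) → X) (y : Fin (k + 1) → Y) : ℝ :=
  φ (x 0) (y 0) * ψ (Fin.tail x) (Fin.tail y)

theorem sum_tens {k : ℕ} (φ : X → Y → ℝ) (ψ : (Fin k → X) → (Fin k → Y) → ℝ) :
    ∑ x, ∑ y, tens φ ψ x y = (∑ x, ∑ y, φ x y) * ∑ x, ∑ y, ψ x y := by
  rw [sum_sum_fin_succ]
  simp only [tens, Fin.cons_zero, Fin.tail_cons, ← Finset.mul_sum, ← Finset.sum_mul]

theorem DiscLE.tens_right {k : ℕ} {φ : X → Y → ℝ} {ψ : (Fin k → X) → (Fin k → Y) → ℝ} {ε M : ℝ}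
    (hφ : DiscLE φ ε) (hε : 0 ≤ ε) (hψ : ∀ x y, 0 ≤ ψ x y) (hM : ∑ x, ∑ y, ψ x y ≤ M) :
    DiscLE (tens φ ψ) (ε * M) := by
  intro A B hA hB
  have e : ∑ x, ∑ y, tens φ ψ x y * (A x * B y) =
      ∑ x : Fin k → X, ∑ y : Fin k → Y, ψ x y * ∑ x₀, ∑ y₀, φ x₀ y₀ *
        (A (Fin.cons x₀ x) * B (Fin.cons y₀ y)) := by
    rw [sum_sum_fin_succ]
    rw [sum_comm_pairs]
    simp only [tens, Fin.cons_zero, Fin.tail_cons, Finset.mul_sum]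
    refine Finset.sum_congr rfl fun _ _ => Finset.sum_congr rfl fun _ _ =>
      Finset.sum_congr rfl fun _ _ => Finset.sum_congr rfl fun _ _ => by ring
  rw [e]
  calc _ ≤ ∑ x : Fin k → X, ∑ y : Fin k → Y, ψ x y * ε := by
        refine (Finset.abs_sum_le_sum_abs _ _).trans (Finset.sum_le_sum fun x _ =>
          (Finset.abs_sum_le_sum_abs _ _).trans (Finset.sum_le_sum fun y _ => ?_))
        rw [abs_mul, abs_of_nonneg (hψ x y)]
        exact mul_le_mul_of_nonneg_left (hφ _ _ (fun _ => hA _) fun _ => hB _) (hψ x y)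
    _ = ε * ∑ x, ∑ y, ψ x y := by simp only [Finset.mul_sum, mul_comm]
    _ ≤ ε * M := mul_le_mul_of_nonneg_left hM hε

theorem DiscLE.tens_left {k : ℕ} {φ : X → Y → ℝ} {ψ : (Fin k → X) → (Fin k → Y) → ℝ} {ε M : ℝ}
    (hψ : DiscLE ψ ε) (hε : 0 ≤ ε) (hφ : ∀ x y, 0 ≤ φ x y) (hM : ∑ x, ∑ y, φ x y ≤ M) :
    DiscLE (tens φ ψ) (M * ε) := by
  intro A B hA hB
  have e : ∑ x, ∑ y, tens φ ψ x y * (A x * B y) =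
      ∑ x₀, ∑ y₀, φ x₀ y₀ * ∑ x : Fin k → X, ∑ y : Fin k → Y, ψ x y *
        (A (Fin.cons x₀ x) * B (Fin.cons y₀ y)) := by
    rw [sum_sum_fin_succ]
    simp only [tens, Fin.cons_zero, Fin.tail_cons, Finset.mul_sum, mul_assoc]
  rw [e]
  calc _ ≤ ∑ x, ∑ y, φ x y * ε := by
        refine (Finset.abs_sum_le_sum_abs _ _).trans (Finset.sum_le_sum fun x _ =>
          (Finset.abs_sum_le_sum_abs _ _).trans (Finset.sum_le_sum fun y _ => ?_))
        rw [abs_mul, abs_of_nonneg (hφ x y)]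
        exact mul_le_mul_of_nonneg_left (hψ _ _ (fun _ => hA _) fun _ => hB _) (hφ x y)
    _ = (∑ x, ∑ y, φ x y) * ε := by simp only [Finset.sum_mul]
    _ ≤ M * ε := mul_le_mul_of_nonneg_right hM hε

/-! ### A hard signed matrix for nested blocks -/

/-- `D` lives on blocks where the predicate `nz` fails, `Q` on blocks where it holds, both are
nonnegative, and `D - Q + P` has small discrepancy for some `P ≥ 0` of mass at most `1 / 2`, while
`D` has mass `1`. -/
structure HardBlock (nz : X → Y → Prop) (D Q P : X → Y → ℝ) (ε : ℝ) : Prop where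
  eps_nonneg : 0 ≤ ε
  D_nonneg : ∀ x y, 0 ≤ D x y
  Q_nonneg : ∀ x y, 0 ≤ Q x y
  P_nonneg : ∀ x y, 0 ≤ P x y
  D_supp : ∀ x y, nz x y → D x y = 0
  Q_supp : ∀ x y, ¬ nz x y → Q x y = 0
  D_mass : ∑ x, ∑ y, D x y = 1
  P_mass : ∑ x, ∑ y, P x y ≤ 1 / 2
  disc : DiscLE (fun x y => D x y - Q x y + P x y) ε

/-- The tensor power `P ⊗ ⋯ ⊗ P`. -/
def tensPow (P : X → Y → ℝ) : (k : ℕ) → (Fin k → X) → (Fin k → Y) → ℝ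
  | 0 => fun _ _ => 1
  | k + 1 => tens P (tensPow P k)

/-- The signed matrix on `k` blocks that is, up to signs alternating with `j`, the sum of the
matrices `D ⊗ ⋯ ⊗ D ⊗ Q ⊗ P ⊗ ⋯ ⊗ P` (with `j` factors `P`) and of `D ⊗ ⋯ ⊗ D`. -/
def nested (D Q P : X → Y → ℝ) : (k : ℕ) → (Fin k → X) → (Fin k → Y) → ℝ
  | 0 => fun _ _ => 1
  | k + 1 => fun x y =>
      tens D (nested D Q P k) x y + (-1) ^ (k + 1) * tens Q (tensPow P k) x y

theorem tensPow_nonneg {X Y : Type*} {P : X → Y → ℝ} (h : ∀ x y, 0 ≤ P x y) :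
    ∀ k x y, 0 ≤ tensPow P k x y
  | 0, _, _ => zero_le_one
  | k + 1, _, _ => mul_nonneg (h _ _) (tensPow_nonneg h k _ _)

theorem sum_tensPow_le {P : X → Y → ℝ} (h : ∀ x y, 0 ≤ P x y) (hP : ∑ x, ∑ y, P x y ≤ 1 / 2)
    (k : ℕ) : ∑ x, ∑ y, tensPow P k x y ≤ (1 / 2) ^ k := by
  induction k with
  | zero => simp [tensPow]
  | succ k ih =>
    rw [tensPow, sum_tens, pow_succ']
    exact mul_le_mul hP ih (Finset.sum_nonneg fun x _ => Finset.sum_nonneg fun y _ =>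
      tensPow_nonneg h k x y) (by norm_num)

variable {nz : X → Y → Prop} {D Q P : X → Y → ℝ} {ε : ℝ}

/-- Replacing `Q` by `D + P` makes the sum defining `nested` telescope to `± P ⊗ ⋯ ⊗ P`. -/
theorem HardBlock.discLE_nested_sub (h : HardBlock nz D Q P ε) (k : ℕ) :
    DiscLE (fun x y => nested D Q P k x y - (-1) ^ k * tensPow P k x y)
      (2 * ε * (1 - (1 / 2) ^ k)) := by
  induction k with
  | zero => intro A B _ _; simp [nested, tensPow]
  | succ k ih =>
    have hp : (0 : ℝ) ≤ 1 - (1 / 2) ^ k := sub_nonneg.mpr (pow_le_one₀ (by norm_num) (by norm_num))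
    have h1 := ih.tens_left (mul_nonneg (mul_nonneg zero_le_two h.eps_nonneg) hp) h.D_nonneg
      h.D_mass.le
    have h2 := (h.disc.tens_right h.eps_nonneg (tensPow_nonneg h.P_nonneg k)
      (sum_tensPow_le h.P_nonneg h.P_mass k)).smul ((-1) ^ k)
    have h3 := h1.add h2
    have e : (fun x y => nested D Q P (k + 1) x y - (-1) ^ (k + 1) * tensPow P (k + 1) x y) =
        fun x y => tens D (fun x y => nested D Q P k x y - (-1) ^ k * tensPow P k x y) x y +
          (-1) ^ k * tens (fun x y => D x y - Q x y + P x y) (tensPow P k) x y := by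
      funext x y
      simp only [nested, tensPow, tens]
      ring
    rw [e]
    refine h3.mono (le_of_eq ?_)
    rw [abs_pow, abs_neg, abs_one, one_pow, pow_succ]
    ring

theorem HardBlock.discLE_nested (h : HardBlock nz D Q P ε) (k : ℕ) :
    DiscLE (nested D Q P k) (2 * ε + (1 / 2) ^ k) := by
  have h1 := (h.discLE_nested_sub k).add
    ((discLE_of_nonneg (tensPow_nonneg h.P_nonneg k)
      (sum_tensPow_le h.P_nonneg h.P_mass k)).smul ((-1) ^ k))
  simp only [sub_add_cancel] at h1
  refine h1.mono ?_
  rw [abs_pow, abs_neg, abs_one, one_pow, one_mul]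
  have : 0 ≤ 2 * ε * (1 / 2) ^ k := mul_nonneg (mul_nonneg zero_le_two h.eps_nonneg) (by positivity)
  linarith

theorem HardBlock.nested_nonneg (h : HardBlock nz D Q P ε) (k : ℕ) (x : Fin k → X) (y : Fin k → Y)
    (hz : ∀ b, ¬ nz (x b) (y b)) : 0 ≤ nested D Q P k x y := by
  induction k with
  | zero => simp [nested]
  | succ k ih =>
    have h0 : Q (x 0) (y 0) = 0 := h.Q_supp _ _ (hz 0)
    simp only [nested, tens, h0, zero_mul, mul_zero, add_zero]
    exact mul_nonneg (h.D_nonneg _ _) (ih _ _ fun b => hz b.succ)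

/-- The sign of `nested` is determined by the first block where `nz` holds. -/
theorem HardBlock.nested_sign (h : HardBlock nz D Q P ε) (k : ℕ) (x : Fin k → X) (y : Fin k → Y)
    (b : Fin k) (hb : nz (x b) (y b)) (hz : ∀ b' < b, ¬ nz (x b') (y b')) :
    0 ≤ (-1) ^ (k + (b : ℕ)) * nested D Q P k x y := by
  induction k with
  | zero => exact b.elim0
  | succ k ih =>
    cases b using Fin.cases with
    | zero =>
      simp only [nested, tens, h.D_supp _ _ hb, zero_mul, zero_add, Fin.val_zero, add_zero]
      rw [← mul_assoc, ← pow_add, Even.neg_one_pow ⟨k + 1, rfl⟩, one_mul]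
      exact mul_nonneg (h.Q_nonneg _ _) (tensPow_nonneg h.P_nonneg k _ _)
    | succ b =>
      have h0 : Q (x 0) (y 0) = 0 := h.Q_supp _ _ (hz 0 (Fin.succ_pos b))
      have h1 := ih (Fin.tail x) (Fin.tail y) b hb fun b' hb' =>
        hz b'.succ (Fin.succ_lt_succ_iff.mpr hb')
      simp only [nested, tens, h0, zero_mul, mul_zero, add_zero, Fin.val_succ]
      rw [show k + 1 + ((b : ℕ) + 1) = k + b + 2 by ring, pow_add]
      have := mul_nonneg (h.D_nonneg (x 0) (y 0)) h1
      linarith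

theorem HardBlock.one_le_sum_abs_nested (h : HardBlock nz D Q P ε) (k : ℕ) :
    1 ≤ ∑ x, ∑ y, |nested D Q P k x y| := by
  induction k with
  | zero => simp [nested]
  | succ k ih =>
    have hle : ∀ x y, tens D (fun x y => |nested D Q P k x y|) x y ≤
        |nested D Q P (k + 1) x y| := by
      intro x y
      by_cases hn : nz (x 0) (y 0)
      · simp [tens, h.D_supp _ _ hn]
      · simp only [nested, tens, h.Q_supp _ _ hn, zero_mul, mul_zero, add_zero, abs_mul,
          abs_of_nonneg (h.D_nonneg _ _), le_refl]
    refine le_trans ?_ (Finset.sum_le_sum fun x _ => Finset.sum_le_sum fun y _ => hle x y)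
    rwa [sum_tens, h.D_mass, one_mul]

end

/-! ### Signed combinations of biased products that vanish in low degree -/

/-- The weights `a i` of sum `-1` annihilate the moments `1, …, d` at the points `16 ^ i`, and their
positive parts have sum less than `1 / 4`. The step multiplies the generating polynomial `∑ a i t ^ i` by
`(16 ^ (d + 1) - t) / (16 ^ (d + 1) - 1)`. -/
theorem exists_moment_weights (d : ℕ) : ∃ a : ℕ → ℝ, (∀ i, d < i → a i = 0) ∧
    (∑ i ∈ Finset.range (d + 1), a i = -1) ∧
    (∀ s, 1 ≤ s → s ≤ d → ∑ i ∈ Finset.range (d + 1), a i * (16 ^ i) ^ s = 0) ∧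
    ∑ i ∈ Finset.range (d + 1), |a i| ≤ 3 / 2 - 1 / 2 ^ (d + 1) := by
  induction d with
  | zero =>
    refine ⟨fun i => if i = 0 then -1 else 0, fun i hi => if_neg (by omega), by simp, ?_, ?_⟩
    · intro s h1 h2; omega
    · norm_num
  | succ d ih =>
    obtain ⟨a, ha0, ha1, has, hal⟩ := ih
    obtain ⟨q, hq⟩ : ∃ q : ℝ, q = 16 ^ (d + 1) := ⟨_, rfl⟩
    have hq8 : 8 * 2 ^ (d + 1) ≤ q := by
      have : (8 : ℝ) ^ 1 ≤ 8 ^ (d + 1) := pow_le_pow_right₀ (by norm_num) (by omega)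
      calc (8 : ℝ) * 2 ^ (d + 1) ≤ 8 ^ (d + 1) * 2 ^ (d + 1) := by gcongr; simpa using this
        _ = q := by rw [hq, ← mul_pow]; norm_num
    have h2 : (2 : ℝ) ≤ 2 ^ (d + 1) := by
      calc (2 : ℝ) = 2 ^ 1 := by norm_num
        _ ≤ 2 ^ (d + 1) := pow_le_pow_right₀ (by norm_num) (by omega)
    have hq1 : 0 < q - 1 := by linarith
    -- the shifted weights
    let b : ℕ → ℝ := fun i => if i = 0 then 0 else a (i - 1)
    have hb : ∀ g : ℕ → ℝ → ℝ, (∀ i, g i 0 = 0) → ∑ i ∈ Finset.range (d + 2), g i (b i) =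
        ∑ i ∈ Finset.range (d + 1), g (i + 1) (a i) := by
      intro g hg
      rw [Finset.sum_range_succ']
      simp [b, hg]
    have ha : ∀ g : ℕ → ℝ → ℝ, (∀ i, g i 0 = 0) → ∑ i ∈ Finset.range (d + 2), g i (a i) =
        ∑ i ∈ Finset.range (d + 1), g i (a i) := by
      intro g hg
      rw [Finset.sum_range_succ, ha0 (d + 1) (by omega), hg, add_zero]
    have hmom : ∀ s, ∑ i ∈ Finset.range (d + 2), (q * a i - b i) / (q - 1) * (16 ^ i) ^ s =
        (q - 16 ^ s) / (q - 1) * ∑ i ∈ Finset.range (d + 1), a i * (16 ^ i) ^ s := by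
      intro s
      have e1 := ha (fun i t => q / (q - 1) * (t * (16 ^ i) ^ s)) (by simp)
      have e2 := hb (fun i t => 1 / (q - 1) * (t * (16 ^ i) ^ s)) (by simp)
      calc _ = ∑ i ∈ Finset.range (d + 2), q / (q - 1) * (a i * (16 ^ i) ^ s) -
            ∑ i ∈ Finset.range (d + 2), 1 / (q - 1) * (b i * (16 ^ i) ^ s) := by
            rw [← Finset.sum_sub_distrib]
            exact Finset.sum_congr rfl fun i _ => by ring
        _ = _ := by
            rw [e1, e2, ← Finset.sum_sub_distrib, Finset.mul_sum]
            refine Finset.sum_congr rfl fun i _ => ?_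
            rw [pow_succ, mul_pow]
            ring
    refine ⟨fun i => (q * a i - b i) / (q - 1), ?_, ?_, ?_, ?_⟩
    · intro i hi
      simp only [b, ha0 i (by omega), if_neg (by omega : ¬ i = 0), ha0 (i - 1) (by omega)]
      simp
    · have := hmom 0
      simp only [pow_zero, mul_one, ha1] at this
      rw [this, div_self hq1.ne']; ring
    · intro s hs1 hs2
      rw [hmom]
      rcases Nat.lt_or_ge d s with h | h
      · have : s = d + 1 := by omega
        subst this
        rw [← hq]; simp
      · rw [has s hs1 h, mul_zero]
    · have e1 := ha (fun i t => q / (q - 1) * |t|) (by simp)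
      have e2 := hb (fun i t => 1 / (q - 1) * |t|) (by simp)
      have hle : ∑ i ∈ Finset.range (d + 2), |(q * a i - b i) / (q - 1)| ≤
          (q + 1) / (q - 1) * ∑ i ∈ Finset.range (d + 1), |a i| := by
        calc _ ≤ ∑ i ∈ Finset.range (d + 2), q / (q - 1) * |a i| +
              ∑ i ∈ Finset.range (d + 2), 1 / (q - 1) * |b i| := by
              rw [← Finset.sum_add_distrib]
              refine Finset.sum_le_sum fun i _ => ?_
              rw [abs_div, abs_of_pos hq1, div_mul_eq_mul_div, div_mul_eq_mul_div, ← add_div]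
              refine (div_le_div_iff_of_pos_right hq1).mpr ((abs_sub _ _).trans (le_of_eq ?_))
              rw [abs_mul, abs_of_pos (by linarith : 0 < q), one_mul]
          _ = _ := by
              rw [e1, e2, ← Finset.mul_sum, ← Finset.mul_sum]; ring
      refine hle.trans ?_
      rw [div_mul_eq_mul_div, div_le_iff₀ hq1, pow_succ 2 (d + 1)]
      generalize (2 : ℝ) ^ (d + 1) = w at *
      have hw : 1 / (w * 2) = 1 / w / 2 := by field_simp
      have hw2 : w * (1 / w) = 1 := by field_simp
      have hw3 : 0 < 1 / w := by positivity
      rw [hw]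
      have h3 : 8 ≤ q * (1 / w) := by nlinarith
      nlinarith

/-- The sign `(-1) ^ z` of a bit. -/
def sg (b : Bool) : ℝ := if b then -1 else 1

/-- The two-party gadget: the row has a string, the column a position in it and a mask bit. -/
def gadget {m : ℕ} (x : Fin m → Bool) (u : Fin m × Bool) : Bool := xor (x u.1) u.2

theorem abs_sg (b : Bool) : |sg b| = 1 := by cases b <;> simp [sg]

theorem sg_gadget {m : ℕ} (x : Fin m → Bool) (u : Fin m × Bool) :
    sg (gadget x u) = chi {u.1} x * sg u.2 := by
  rw [chi, Finset.sum_singleton, gadget]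
  cases x u.1 <;> cases u.2 <;> simp [sg]

theorem sum_abs_sum_gadget (m : ℕ) : ∑ u : Fin m × Bool, ∑ u' : Fin m × Bool,
    |∑ x : Fin m → Bool, sg (gadget x u) * sg (gadget x u')| = 4 * m * 2 ^ m := by
  have h : ∀ u u' : Fin m × Bool, |∑ x : Fin m → Bool, sg (gadget x u) * sg (gadget x u')| =
      if u.1 = u'.1 then 2 ^ m else 0 := by
    intro u u'
    have e : ∑ x : Fin m → Bool, sg (gadget x u) * sg (gadget x u') =
        sg u.2 * sg u'.2 * ∑ x, chi (symmDiff {u.1} {u'.1}) x := by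
      rw [Finset.mul_sum]
      refine Finset.sum_congr rfl fun x _ => ?_
      rw [sg_gadget, sg_gadget, ← chi_mul_chi]; ring
    rw [e, abs_mul, abs_mul, abs_sg, abs_sg, one_mul, one_mul]
    split_ifs with h
    · rw [h, symmDiff_self]
      simp [chi_empty]
    · rw [sum_chi_of_nonempty, abs_zero]
      exact ⟨u.1, by simp [Finset.mem_symmDiff, h]⟩
  rw [Finset.sum_congr rfl fun u _ => Finset.sum_congr rfl fun u' _ => h u u']
  simp only [Fintype.sum_prod_type_right, Finset.sum_ite_eq, Finset.mem_univ, if_true,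
    Finset.sum_const, Finset.card_univ, Fintype.card_prod, Fintype.card_fin, Fintype.card_bool,
    nsmul_eq_mul]
  push_cast
  ring

theorem sum_gadget {m : ℕ} (x : Fin m → Bool) : ∑ u : Fin m × Bool, sg (gadget x u) = 0 := by
  rw [Fintype.sum_prod_type]
  refine Finset.sum_eq_zero fun v _ => ?_
  rw [Fintype.sum_bool]
  cases h : x v <;> simp [gadget, sg, h]

/-- The number of pairs of inputs of `N` gadgets. -/
noncomputable def gadgetPairs (N m : ℕ) : ℝ := (2 ^ m) ^ N * (2 * m) ^ N

/-- The parity of `|S|` gadgets on columns of length `μ ^ 2` has discrepancy `μ ^ (-|S|)` relative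
to the uniform distribution. The proof is Cauchy's inequality over the rows. -/
theorem discLE_prod_gadget {N m μ : ℕ} (hμ : 0 < μ) (hm : m = μ * μ) (S : Finset (Fin N)) :
    DiscLE (fun (x : Fin N → Fin m → Bool) (y : Fin N → Fin m × Bool) =>
      ∏ i ∈ S, sg (gadget (x i) (y i))) (gadgetPairs N m * (1 / (μ : ℝ)) ^ S.card) := by
  intro A B hA hB
  set G : (Fin N → Fin m → Bool) → ℝ := fun x => ∑ y : Fin N → Fin m × Bool,
    (∏ i ∈ S, sg (gadget (x i) (y i))) * B y with hG
  have e1 : ∑ x, ∑ y : Fin N → Fin m × Bool, (∏ i ∈ S, sg (gadget (x i) (y i))) * (A x * B y) =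
      ∑ x, A x * G x := by
    simp only [hG, Finset.mul_sum]
    exact Finset.sum_congr rfl fun x _ => Finset.sum_congr rfl fun y _ => by ring
  have hcs := Finset.sum_mul_sq_le_sq_mul_sq Finset.univ A G
  have hAs : ∑ x, A x ^ 2 ≤ (2 ^ m) ^ N := by
    refine (Finset.sum_le_card_nsmul _ _ 1 fun x _ => ?_).trans (le_of_eq (by simp))
    rw [← sq_abs]
    exact pow_le_one₀ (abs_nonneg _) (hA x)
  have hGs : ∑ x, G x ^ 2 ≤ (2 ^ m) ^ N * ((2 * m) ^ N) ^ 2 * ((1 / (μ : ℝ)) ^ S.card) ^ 2 := by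
    have e2 : ∑ x, G x ^ 2 = ∑ y : Fin N → Fin m × Bool, ∑ y' : Fin N → Fin m × Bool,
        B y * B y' * ∑ x : Fin N → Fin m → Bool, ∏ i, (if i ∈ S then
          sg (gadget (x i) (y i)) * sg (gadget (x i) (y' i)) else 1) := by
      simp only [hG, sq, Finset.sum_mul_sum]
      rw [Finset.sum_comm]
      refine Finset.sum_congr rfl fun y _ => ?_
      rw [Finset.sum_comm]
      refine Finset.sum_congr rfl fun y' _ => ?_
      rw [Finset.mul_sum]
      refine Finset.sum_congr rfl fun x _ => ?_
      rw [Finset.prod_ite_mem, Finset.univ_inter, Finset.prod_mul_distrib]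
      ring
    rw [e2]
    calc _ ≤ ∑ y : Fin N → Fin m × Bool, ∑ y' : Fin N → Fin m × Bool,
          ∏ i, |∑ x : Fin m → Bool, if i ∈ S then
            sg (gadget x (y i)) * sg (gadget x (y' i)) else 1| := by
          refine Finset.sum_le_sum fun y _ => Finset.sum_le_sum fun y' _ => ?_
          rw [sum_pi_prod fun i (x : Fin m → Bool) => if i ∈ S then
            sg (gadget x (y i)) * sg (gadget x (y' i)) else 1, ← Finset.abs_prod]
          refine (le_abs_self _).trans ?_
          rw [abs_mul, abs_mul]
          exact mul_le_of_le_one_left (abs_nonneg _)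
            (mul_le_one₀ (hB y) (abs_nonneg _) (hB y'))
      _ = ∏ i : Fin N, ∑ u : Fin m × Bool, ∑ u' : Fin m × Bool, |∑ x : Fin m → Bool,
            if i ∈ S then sg (gadget x u) * sg (gadget x u') else 1| := by
          rw [← sum_pi_prod fun i (u : Fin m × Bool) => ∑ u' : Fin m × Bool,
            |∑ x : Fin m → Bool, if i ∈ S then sg (gadget x u) * sg (gadget x u') else 1|]
          refine Finset.sum_congr rfl fun y _ => ?_
          rw [← sum_pi_prod fun i (u' : Fin m × Bool) =>
            |∑ x : Fin m → Bool, if i ∈ S then sg (gadget x (y i)) * sg (gadget x u') else 1|]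
      _ = ∏ i : Fin N, (2 ^ m * (2 * (m : ℝ)) ^ 2) * (if i ∈ S then (1 / (μ : ℝ)) ^ 2 else 1) := by
          refine Finset.prod_congr rfl fun i _ => ?_
          by_cases hi : i ∈ S
          · simp only [if_pos hi]
            rw [sum_abs_sum_gadget, hm]
            push_cast
            field_simp
            ring
          · simp only [if_neg hi]
            simp
            ring
      _ = _ := by
          generalize 2 * (m : ℝ) = t
          rw [Finset.prod_mul_distrib, Finset.prod_ite_mem, Finset.univ_inter, Finset.prod_const,
            Finset.prod_const, Finset.card_univ, Fintype.card_fin]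
          ring
  rw [e1]
  refine abs_le_of_sq_le_sq (hcs.trans ?_) (by rw [gadgetPairs]; positivity)
  calc _ ≤ (2 ^ m) ^ N * ((2 ^ m) ^ N * ((2 * m) ^ N) ^ 2 * ((1 / (μ : ℝ)) ^ S.card) ^ 2) :=
        mul_le_mul hAs hGs (Finset.sum_nonneg fun _ _ => sq_nonneg _) (by positivity)
    _ = _ := by rw [gadgetPairs]; ring

/-- The density, with respect to the uniform distribution, of the distribution under which the
outputs of the gadgets are independent bits of expected sign `ρ`. -/
def biased {N m : ℕ} (ρ : ℝ) (x : Fin N → Fin m → Bool) (y : Fin N → Fin m × Bool) : ℝ :=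
  ∏ i, (1 + ρ * sg (gadget (x i) (y i)))

theorem biased_nonneg {N m : ℕ} {ρ : ℝ} (h : |ρ| ≤ 1) (x : Fin N → Fin m → Bool)
    (y : Fin N → Fin m × Bool) : 0 ≤ biased ρ x y := by
  refine Finset.prod_nonneg fun i _ => ?_
  have h1 : |ρ * sg (gadget (x i) (y i))| ≤ 1 := by rwa [abs_mul, abs_sg, mul_one]
  linarith [(abs_le.mp h1).1]

theorem biased_eq_sum {N m : ℕ} (ρ : ℝ) (x : Fin N → Fin m → Bool) (y : Fin N → Fin m × Bool) :
    biased ρ x y = ∑ S : Finset (Fin N), ρ ^ S.card * ∏ i ∈ S, sg (gadget (x i) (y i)) := by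
  rw [biased, Finset.prod_one_add, Finset.powerset_univ]
  exact Finset.sum_congr rfl fun S _ => by rw [Finset.prod_mul_distrib, Finset.prod_const]

theorem sum_biased {N m : ℕ} (ρ : ℝ) :
    ∑ x : Fin N → Fin m → Bool, ∑ y : Fin N → Fin m × Bool, biased ρ x y = gadgetPairs N m := by
  have h : ∀ x : Fin N → Fin m → Bool, ∑ y : Fin N → Fin m × Bool, biased ρ x y =
      (2 * m) ^ N := by
    intro x
    simp only [biased]
    rw [sum_pi_prod fun i u => 1 + ρ * sg (gadget (x i) u)]
    simp only [Finset.sum_add_distrib, ← Finset.mul_sum, sum_gadget]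
    simp [mul_comm]
  rw [Finset.sum_congr rfl fun x _ => h x, gadgetPairs]
  simp

theorem biased_of_all_false {N m : ℕ} (ρ : ℝ) {x : Fin N → Fin m → Bool}
    {y : Fin N → Fin m × Bool} (h : ∀ i, gadget (x i) (y i) = false) :
    biased ρ x y = (1 + ρ) ^ N := by
  simp [biased, h, sg]

theorem biased_one_eq_zero {N m : ℕ} {x : Fin N → Fin m → Bool}
    {y : Fin N → Fin m × Bool} (h : ∃ i, gadget (x i) (y i) = true) : biased 1 x y = 0 := by
  obtain ⟨i, hi⟩ := h
  exact Finset.prod_eq_zero (Finset.mem_univ i) (by simp [hi, sg])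

/-- A combination of biased densities that vanishes on all parities of at most `d` gadgets has
small discrepancy. -/
theorem discLE_sum_biased {N m μ d : ℕ} (hN : 0 < N) (hNμ : N ≤ μ) (hm : m = μ * μ)
    {ι : Type*} (s : Finset ι) (c ρ : ι → ℝ) (hρ : ∀ i ∈ s, |ρ i| ≤ 1)
    (hc : ∀ k ≤ d, ∑ i ∈ s, c i * ρ i ^ k = 0) :
    DiscLE (fun (x : Fin N → Fin m → Bool) (y : Fin N → Fin m × Bool) =>
        ∑ i ∈ s, c i * biased (ρ i) x y)
      ((∑ i ∈ s, |c i|) * gadgetPairs N m * (3 * ((N : ℝ) / μ) ^ (d + 1))) := by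
  set L := ∑ i ∈ s, |c i| with hL
  have hL0 : 0 ≤ L := Finset.sum_nonneg fun _ _ => abs_nonneg _
  have hμ : (0 : ℝ) < μ := by exact_mod_cast hN.trans_le hNμ
  have hN' : (0 : ℝ) < N := by exact_mod_cast hN
  have hU : 0 ≤ gadgetPairs N m := by rw [gadgetPairs]; positivity
  have e : (fun (x : Fin N → Fin m → Bool) (y : Fin N → Fin m × Bool) =>
      ∑ i ∈ s, c i * biased (ρ i) x y) = fun x y => ∑ S : Finset (Fin N),
        (∑ i ∈ s, c i * ρ i ^ S.card) * ∏ i ∈ S, sg (gadget (x i) (y i)) := by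
    funext x y
    simp only [biased_eq_sum, Finset.mul_sum, Finset.sum_mul]
    rw [Finset.sum_comm]
    exact Finset.sum_congr rfl fun S _ => Finset.sum_congr rfl fun i _ => by ring
  rw [e]
  refine (DiscLE.sum Finset.univ fun S _ =>
    (discLE_prod_gadget (hN.trans_le hNμ) hm S).smul (∑ i ∈ s, c i * ρ i ^ S.card)).mono ?_
  have hterm : ∀ S : Finset (Fin N), |∑ i ∈ s, c i * ρ i ^ S.card| *
      (gadgetPairs N m * (1 / (μ : ℝ)) ^ S.card) ≤
        L * gadgetPairs N m * ((N : ℝ) / μ) ^ (d + 1) * (1 / (N : ℝ)) ^ S.card := by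
    intro S
    rcases Nat.lt_or_ge d S.card with h | h
    · have h1 : |∑ i ∈ s, c i * ρ i ^ S.card| ≤ L := by
        refine (Finset.abs_sum_le_sum_abs _ _).trans (Finset.sum_le_sum fun i hi => ?_)
        rw [abs_mul, abs_pow]
        exact mul_le_of_le_one_right (abs_nonneg _) (pow_le_one₀ (abs_nonneg _) (hρ i hi))
      have h2 : (1 / (μ : ℝ)) ^ S.card ≤ ((N : ℝ) / μ) ^ (d + 1) * (1 / (N : ℝ)) ^ S.card := by
        have h3 : (1 / (μ : ℝ)) ^ S.card = ((N : ℝ) / μ) ^ S.card * (1 / (N : ℝ)) ^ S.card := by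
          rw [← mul_pow]; congr 1; field_simp
        rw [h3]
        refine mul_le_mul_of_nonneg_right ?_ (by positivity)
        refine pow_le_pow_of_le_one (by positivity) ?_ h
        rw [div_le_one hμ]
        exact_mod_cast hNμ
      calc _ ≤ L * (gadgetPairs N m * (((N : ℝ) / μ) ^ (d + 1) * (1 / (N : ℝ)) ^ S.card)) := by
            gcongr
        _ = _ := by ring
    · rw [hc _ h, abs_zero, zero_mul]
      positivity
  refine (Finset.sum_le_sum fun S _ => hterm S).trans ?_
  rw [← Finset.mul_sum]
  have hsum : ∑ S : Finset (Fin N), (1 / (N : ℝ)) ^ S.card = (1 + 1 / (N : ℝ)) ^ N := by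
    have := Finset.prod_one_add (R := ℝ) (s := (Finset.univ : Finset (Fin N)))
      (f := fun _ => 1 / (N : ℝ))
    simp only [Finset.prod_const, Finset.card_univ, Fintype.card_fin, Finset.powerset_univ] at this
    exact this.symm
  have h3 : (1 + 1 / (N : ℝ)) ^ N ≤ 3 := by
    calc (1 + 1 / (N : ℝ)) ^ N ≤ (Real.exp (1 / N)) ^ N := by
          gcongr
          linarith [Real.add_one_le_exp (1 / (N : ℝ))]
      _ = Real.exp 1 := by rw [← Real.exp_nat_mul]; congr 1; field_simp
      _ ≤ 3 := by linarith [Real.exp_one_lt_d9]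
  rw [hsum]
  calc _ ≤ L * gadgetPairs N m * ((N : ℝ) / μ) ^ (d + 1) * 3 := by gcongr
    _ = _ := by ring

/-- The weights of `exists_moment_weights`, placed at the expected signs `1 - 2 · 16 ^ i / 16 ^ d`,
turn into a hard block: the part of positive weight becomes `P`, and the part of negative weight,
restricted to the blocks with a nonzero gadget, becomes `Q`. The rest of the negative part is a
multiple of `D`. -/
theorem exists_hardBlock (d : ℕ) {N μ m : ℕ} (hN : N = 4 * 16 ^ d) (hμ : μ = N * N)
    (hm : m = μ * μ) : ∃ D Q P, HardBlock (X := Fin N → Fin m → Bool) (Y := Fin N → Fin m × Bool)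
      (fun x y => ∃ i, gadget (x i) (y i) = true) D Q P (11 * (1 / (N : ℝ)) ^ (d + 1)) := by
  classical
  obtain ⟨a, -, ha1, has, hal⟩ := exists_moment_weights d
  have hN0 : 0 < N := by rw [hN]; positivity
  have hNR : (0 : ℝ) < N := by exact_mod_cast hN0
  have hμ0 : 0 < μ := by rw [hμ]; positivity
  have hm0 : 0 < m := by rw [hm]; positivity
  have hmR : (0 : ℝ) < m := by exact_mod_cast hm0
  have hU : 0 < gadgetPairs N m := by rw [gadgetPairs]; positivity
  set U := gadgetPairs N m
  set I := Finset.range (d + 1)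
  -- the biases and the expected signs
  let θ : ℕ → ℝ := fun i => 16 ^ i / 16 ^ d
  let ρ : ℕ → ℝ := fun i => 1 - 2 * θ i
  have hθ0 : ∀ i, 1 / 16 ^ d ≤ θ i := fun i =>
    div_le_div_of_nonneg_right (one_le_pow₀ (by norm_num)) (by positivity)
  have hθ1 : ∀ i ∈ I, θ i ≤ 1 := fun i hi =>
    (div_le_one (by positivity)).mpr (pow_le_pow_right₀ (by norm_num)
      (Nat.lt_succ_iff.mp (Finset.mem_range.mp hi)))
  have hθpos : ∀ i, 0 < θ i := fun i => lt_of_lt_of_le (by positivity) (hθ0 i)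
  have hρ : ∀ i ∈ I, |ρ i| ≤ 1 := fun i hi =>
    abs_le.mpr ⟨by have := hθ1 i hi; simp only [ρ]; linarith,
      by have := hθpos i; simp only [ρ]; linarith⟩
  have hmom : ∀ k ≤ d, ∑ i ∈ I, a i * ρ i ^ k = -1 := by
    intro k hk
    have e : ∀ i, a i * ρ i ^ k = ∑ r ∈ Finset.range (k + 1),
        (-2 / 16 ^ d) ^ r * (k.choose r : ℝ) * (a i * (16 ^ i) ^ r) := by
      intro i
      have : ρ i = -2 / 16 ^ d * 16 ^ i + 1 := by simp only [ρ, θ]; ring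
      rw [this, add_pow, Finset.mul_sum]
      refine Finset.sum_congr rfl fun r _ => ?_
      rw [one_pow, mul_pow]; ring
    rw [Finset.sum_congr rfl fun i _ => e i, Finset.sum_comm, Finset.sum_range_succ',
      Finset.sum_eq_zero]
    · simp [I, ha1]
    · intro r hr
      rw [← Finset.mul_sum, has (r + 1) (by omega) (by have := Finset.mem_range.mp hr; omega),
        mul_zero]
  -- under a positive bias all gadgets vanish with probability at most `1 / 4`
  have hτ : ∀ i ∈ I, (1 + ρ i) ^ N ≤ 1 / 4 * 2 ^ N := by
    intro i hi
    have h1 : (1 + ρ i) ^ N = (1 - θ i) ^ N * 2 ^ N := by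
      rw [← mul_pow]; congr 1; simp only [ρ]; ring
    have h2 : (1 - θ i) ^ N * (1 + θ i) ^ N ≤ 1 := by
      rw [← mul_pow]
      refine pow_le_one₀ (mul_nonneg (by linarith [hθ1 i hi]) (by linarith [hθpos i])) ?_
      nlinarith [sq_nonneg (θ i)]
    have h3 : 4 ≤ (1 + θ i) ^ N := by
      have h4 : (4 : ℝ) ≤ N * θ i := by
        calc (4 : ℝ) = N * (1 / 16 ^ d) := by rw [hN]; push_cast; field_simp
          _ ≤ N * θ i := mul_le_mul_of_nonneg_left (hθ0 i) hNR.le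
      have := one_add_mul_le_pow (a := θ i) (by linarith [hθpos i]) N
      linarith
    have h5 : 0 ≤ (1 - θ i) ^ N := pow_nonneg (by linarith [hθ1 i hi]) _
    rw [h1]
    refine mul_le_mul_of_nonneg_right ?_ (by positivity)
    nlinarith
  have hpm : ∀ t : ℝ, max t 0 - max (-t) 0 = t ∧ max t 0 + max (-t) 0 = |t| := by
    intro t
    rcases le_total 0 t with h | h
    · rw [max_eq_left h, max_eq_right (by linarith), abs_of_nonneg h]; simp
    · rw [max_eq_right h, max_eq_left (by linarith), abs_of_nonpos h]; simp
  have hp0 : ∀ t : ℝ, 0 ≤ max t 0 := fun t => le_max_right _ _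
  have hsum1 : ∑ i ∈ I, max (a i) 0 - ∑ i ∈ I, max (-a i) 0 = -1 := by
    rw [← Finset.sum_sub_distrib, ← ha1]
    exact Finset.sum_congr rfl fun i _ => (hpm _).1
  have hsum2 : ∑ i ∈ I, max (a i) 0 + ∑ i ∈ I, max (-a i) 0 ≤ 3 / 2 := by
    rw [← Finset.sum_add_distrib, Finset.sum_congr rfl fun i _ => (hpm (a i)).2]
    exact hal.trans (by linarith [(by positivity : (0 : ℝ) < 1 / 2 ^ (d + 1))])
  set β := ∑ i ∈ I, max (-a i) 0 * ((1 + ρ i) ^ N / 2 ^ N) with hβ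
  have hβle : β ≤ 5 / 16 := by
    calc β ≤ ∑ i ∈ I, max (-a i) 0 * (1 / 4) := by
          refine Finset.sum_le_sum fun i hi => mul_le_mul_of_nonneg_left ?_ (hp0 _)
          rw [div_le_iff₀ (by positivity)]
          exact hτ i hi
      _ ≤ 5 / 16 := by rw [← Finset.sum_mul]; linarith
  have hβ1 : 0 < 1 - β := by linarith
  set w := 1 / (U * (1 - β)) with hw
  have hw0 : 0 < w := by positivity
  have hbn : ∀ i ∈ I, ∀ (x : Fin N → Fin m → Bool) (y : Fin N → Fin m × Bool),
      0 ≤ biased (ρ i) x y := fun i hi => biased_nonneg (hρ i hi)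
  refine ⟨fun x y => biased 1 x y / U,
    fun x y => if ∃ i, gadget (x i) (y i) = true then
      w * ∑ i ∈ I, max (-a i) 0 * biased (ρ i) x y else 0,
    fun x y => w * ∑ i ∈ I, max (a i) 0 * biased (ρ i) x y, ?_, ?_, ?_, ?_, ?_, ?_, ?_, ?_, ?_⟩
  · positivity
  · exact fun x y => div_nonneg (biased_nonneg (by simp) x y) hU.le
  · intro x y
    split_ifs
    · exact mul_nonneg hw0.le (Finset.sum_nonneg fun i hi => mul_nonneg (hp0 _) (hbn i hi x y))
    · exact le_rfl
  · exact fun x y =>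
      mul_nonneg hw0.le (Finset.sum_nonneg fun i hi => mul_nonneg (hp0 _) (hbn i hi x y))
  · intro x y h
    simp only [biased_one_eq_zero h, zero_div]
  · intro x y h
    exact if_neg h
  · simp only [← Finset.sum_div]
    rw [sum_biased, div_self hU.ne']
  · have e : ∑ x : Fin N → Fin m → Bool, ∑ y : Fin N → Fin m × Bool,
        w * ∑ i ∈ I, max (a i) 0 * biased (ρ i) x y = w * ((∑ i ∈ I, max (a i) 0) * U) := by
      simp only [← Finset.mul_sum]
      rw [Finset.sum_mul]
      congr 1
      rw [Finset.sum_congr rfl fun x _ => Finset.sum_comm, Finset.sum_comm]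
      refine Finset.sum_congr rfl fun i _ => ?_
      simp only [← Finset.mul_sum]
      rw [sum_biased]
    rw [e, hw, div_mul_eq_mul_div, one_mul, div_le_iff₀ (by positivity)]
    nlinarith
  · let c : ℕ → ℝ := fun i => if i = 0 then 1 else a (i - 1)
    let ρ' : ℕ → ℝ := fun i => if i = 0 then 1 else ρ (i - 1)
    have hc : ∀ g : ℝ → ℝ → ℝ, ∑ i ∈ Finset.range (d + 2), g (c i) (ρ' i) =
        ∑ i ∈ I, g (a i) (ρ i) + g 1 1 := by
      intro g
      rw [Finset.sum_range_succ']
      simp [c, ρ', I]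
    have hdisc := discLE_sum_biased (d := d) hN0 (by rw [hμ]; exact Nat.le_mul_self N) hm
      (Finset.range (d + 2)) c ρ'
      (by
        intro i hi
        rcases Nat.eq_zero_or_pos i with rfl | h
        · simp [ρ']
        · simp only [ρ', if_neg h.ne']
          exact hρ _ (Finset.mem_range.mpr (by have := Finset.mem_range.mp hi; omega)))
      (by
        intro k hk
        rw [hc fun s t => s * t ^ k, hmom k hk]
        simp)
    have hle := hdisc.smul w
    have e : (fun (x : Fin N → Fin m → Bool) (y : Fin N → Fin m × Bool) => biased 1 x y / U -
        (if ∃ i, gadget (x i) (y i) = true then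
          w * ∑ i ∈ I, max (-a i) 0 * biased (ρ i) x y else 0) +
        w * ∑ i ∈ I, max (a i) 0 * biased (ρ i) x y) =
        fun x y => w * ∑ i ∈ Finset.range (d + 2), c i * biased (ρ' i) x y := by
      funext x y
      rw [hc fun s t => s * biased t x y]
      have h1 : ∑ i ∈ I, a i * biased (ρ i) x y = ∑ i ∈ I, max (a i) 0 * biased (ρ i) x y -
          ∑ i ∈ I, max (-a i) 0 * biased (ρ i) x y := by
        rw [← Finset.sum_sub_distrib]
        refine Finset.sum_congr rfl fun i _ => ?_
        rw [← sub_mul, (hpm (a i)).1]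
      rw [h1]
      split_ifs with h
      · rw [biased_one_eq_zero h]; ring
      · have h2 : ∀ i, gadget (x i) (y i) = false := by simpa using h
        have h3 : ∑ i ∈ I, max (-a i) 0 * biased (ρ i) x y = β * biased 1 x y := by
          rw [hβ, Finset.sum_mul]
          refine Finset.sum_congr rfl fun i _ => ?_
          rw [biased_of_all_false _ h2, biased_of_all_false _ h2]
          norm_num
          field_simp
        rw [h3, hw]
        field_simp
        ring
    rw [e]
    refine hle.mono ?_
    have hL : ∑ i ∈ Finset.range (d + 2), |c i| ≤ 5 / 2 := by
      rw [hc fun s _ => |s|, abs_one, Finset.sum_congr rfl fun i _ => (hpm (a i)).2.symm,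
        Finset.sum_add_distrib]
      linarith
    have hr : (N : ℝ) / μ = 1 / N := by rw [hμ]; push_cast; field_simp
    rw [hr, abs_of_pos hw0]
    have hpos : (0 : ℝ) < (1 / (N : ℝ)) ^ (d + 1) := by positivity
    calc w * ((∑ i ∈ Finset.range (d + 2), |c i|) * U * (3 * (1 / (N : ℝ)) ^ (d + 1)))
        ≤ w * (5 / 2 * U * (3 * (1 / (N : ℝ)) ^ (d + 1))) := by gcongr
      _ = 15 / 2 / (1 - β) * (1 / (N : ℝ)) ^ (d + 1) := by
          rw [hw]; field_simp; ring
      _ ≤ 11 * (1 / (N : ℝ)) ^ (d + 1) := by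
          refine mul_le_mul_of_nonneg_right ?_ hpos.le
          rw [div_le_iff₀ hβ1]
          linarith

/-! ### The first active pair -/

/-- The `t`-th pair of variables is active if both its variables are `1`. -/
def active {n : ℕ} (x : Fin n → Bool) (t : ℕ) : Bool := getBit x (2 * t) && getBit x (2 * t + 1)

/-- The family that asks whether the index of the first active pair is odd. -/
def firstActive : BoolFamily := fun n x =>
  decide (∃ t < n, t % 2 = 1 ∧ active x t = true ∧ ∀ s < t, active x s = false)

theorem lt_of_active {n : ℕ} {x : Fin n → Bool} {t : ℕ} (h : active x t = true) :
    2 * t + 1 < n := by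
  by_contra hn
  rw [active, getBit_of_le x (not_lt.mp hn), Bool.and_false] at h
  exact Bool.false_ne_true h

theorem firstActive_of_first {n : ℕ} {x : Fin n → Bool} {t : ℕ} (h : active x t = true)
    (hs : ∀ s < t, active x s = false) : firstActive n x = decide (t % 2 = 1) := by
  refine decide_eq_decide.mpr ⟨?_, fun h2 => ⟨t, by have := lt_of_active h; omega, h2, h, hs⟩⟩
  rintro ⟨t', -, h1, h2, h3⟩
  rcases lt_trichotomy t t' with hlt | rfl | hlt
  · rw [h3 t hlt] at h; exact absurd h Bool.false_ne_true
  · exact h1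
  · rw [hs t' hlt] at h2; exact absurd h2 Bool.false_ne_true

theorem firstActive_of_none {n : ℕ} {x : Fin n → Bool} (h : ∀ t, active x t = false) :
    firstActive n x = false := by
  refine decide_eq_false ?_
  rintro ⟨t, -, -, h2, -⟩
  rw [h t] at h2
  exact Bool.false_ne_true h2

/-- The query asking whether the `t`-th pair is active. -/
noncomputable def activeQuery (n t : ℕ) : LinThr n :=
  ⟨-1, fun j => if j ∈ pairSet n t then 1 else 0⟩

theorem activeQuery_eval {n t : ℕ} (h : 2 * t + 1 < n) (x : Fin n → Bool) :
    (activeQuery n t).eval x = active x t := by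
  have h0 : 2 * t < n := by omega
  simp only [LinThr.eval, activeQuery, ite_mul, one_mul, zero_mul, Finset.sum_ite_mem,
    Finset.univ_inter]
  rw [sum_pairSet h]
  simp only [active, getBit, h, h0, dif_pos]
  cases x ⟨2 * t, h0⟩ <;> cases x ⟨2 * t + 1, h⟩ <;> norm_num [sgn, bit]

theorem listEval_append_of_forall {n : ℕ} (l l' : List (LinThr n × Bool)) (x : Fin n → Bool)
    (h : ∀ q ∈ l, q.1.eval x = false) : listEval (l ++ l') x = listEval l' x := by
  induction l with
  | nil => rfl
  | cons q l ih =>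
    rw [List.cons_append, listEval, h q List.mem_cons_self, if_neg Bool.false_ne_true,
      ih fun q' hq' => h q' (List.mem_cons_of_mem q hq')]

/-- The linear decision list that tries the pairs in order. -/
noncomputable def activeList (n : ℕ) : List (LinThr n × Bool) :=
  ((List.range (n / 2)).map fun t => (activeQuery n t, decide (t % 2 = 1))) ++
    [(⟨1, fun _ => 0⟩, false)]

theorem listEval_activeList (n : ℕ) (x : Fin n → Bool) :
    listEval (activeList n) x = firstActive n x := by
  by_cases h : ∃ t, active x t = true
  · classical
    obtain ⟨t, ht, hs⟩ : ∃ t, active x t = true ∧ ∀ s < t, active x s = false :=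
      ⟨Nat.find h, Nat.find_spec h, fun s hs => by simpa using Nat.find_min h hs⟩
    have hlt := lt_of_active ht
    obtain ⟨r, hr⟩ : ∃ r, n / 2 = t + (r + 1) := ⟨n / 2 - t - 1, by omega⟩
    rw [firstActive_of_first ht hs, activeList, hr, List.range_add, List.range_succ_eq_map]
    simp only [List.map_append, List.map_cons, List.append_assoc, List.cons_append, add_zero]
    rw [listEval_append_of_forall, listEval, if_pos]
    · rw [activeQuery_eval hlt, ht]
    · intro q hq
      obtain ⟨s, hs', rfl⟩ := List.mem_map.mp hq
      have hst := List.mem_range.mp hs'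
      rw [activeQuery_eval (by omega), hs s hst]
  · have h' : ∀ t, active x t = false := by simpa using h
    rw [firstActive_of_none h', activeList, listEval_append_of_forall]
    · simp [listEval]
    · intro q hq
      obtain ⟨s, hs', rfl⟩ := List.mem_map.mp hq
      have hst := List.mem_range.mp hs'
      rw [activeQuery_eval (by omega), h' s]

theorem firstActive_mem_LDLhat : firstActive ∈ LDLhat := by
  refine ⟨Polynomial.X + 1, 1, fun n => ⟨activeList n, ⟨by simp [activeList], fun x => ?_⟩, ?_, ?_,
    listEval_activeList n⟩⟩
  · simp [activeList, LinThr.eval, sgn]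
  · simp [activeList]
    omega
  · intro q hq
    rcases List.mem_append.mp hq with h | h
    · obtain ⟨t, -, rfl⟩ := List.mem_map.mp h
      refine ⟨⟨-1, by simp [activeQuery], by simp⟩, fun j => ?_⟩
      by_cases hj : j ∈ pairSet n t
      · exact ⟨1, by simp [activeQuery, hj], by simp⟩
      · exact ⟨0, by simp [activeQuery, hj], by simp⟩
    · rw [List.mem_singleton.mp h]
      exact ⟨⟨1, by simp, by simp⟩, fun j => ⟨0, by simp, by simp⟩⟩

/-! ### Blocks of gadgets inside the first-active-pair function -/

/-- The pair of variables reserved for the value `p.2` of the column input of the gadget `p.1` in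
the block `b`. Pairs of later blocks come later, and the parity of the position is that of `b`. -/
noncomputable def pairPos {N m : ℕ} (b : ℕ) (p : Fin N × (Fin m × Bool)) : ℕ :=
  2 * (b * (N * (m * 2)) + Fintype.equivFinOfCardEq (n := N * (m * 2)) (by simp) p) + b % 2

theorem pairPos_mod_two {N m : ℕ} (b : ℕ) (p : Fin N × (Fin m × Bool)) :
    pairPos b p % 2 = b % 2 := by
  rw [pairPos]; omega

theorem pairPos_lt {N m : ℕ} {b b' : ℕ} (h : b < b') (p p' : Fin N × (Fin m × Bool)) :
    pairPos b p < pairPos b' p' := by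
  have h1 := (Fintype.equivFinOfCardEq (n := N * (m * 2)) (by simp) p).2
  rw [pairPos, pairPos]
  have h2 : (b + 1) * (N * (m * 2)) ≤ b' * (N * (m * 2)) := Nat.mul_le_mul_right _ h
  rw [add_mul, one_mul] at h2
  omega

theorem pairPos_lt_of_lt {N m : ℕ} {b k : ℕ} (h : b < k) (p : Fin N × (Fin m × Bool)) :
    pairPos b p < 2 * (k * (N * (m * 2))) := by
  have h1 := (Fintype.equivFinOfCardEq (n := N * (m * 2)) (by simp) p).2
  rw [pairPos]
  have h2 : (b + 1) * (N * (m * 2)) ≤ k * (N * (m * 2)) := Nat.mul_le_mul_right _ h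
  rw [add_mul, one_mul] at h2
  omega

theorem pairPos_injective {N m : ℕ} {b b' : ℕ} {p p' : Fin N × (Fin m × Bool)}
    (h : pairPos b p = pairPos b' p') : b = b' ∧ p = p' := by
  have hb : b = b' := by
    rcases lt_trichotomy b b' with h1 | h1 | h1
    · exact absurd h (pairPos_lt h1 p p').ne
    · exact h1
    · exact absurd h.symm (pairPos_lt h1 p' p).ne
  subst hb
  refine ⟨rfl, (Fintype.equivFinOfCardEq (n := N * (m * 2)) (by simp)).injective (Fin.ext ?_)⟩
  rw [pairPos, pairPos] at h
  omega

open Classical in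
/-- The row bits: the truth tables of the gadgets as functions of their column inputs. -/
noncomputable def rowBits {k N m : ℕ} (x : Fin k → Fin N → Fin m → Bool) (t : ℕ) : Bool :=
  decide (∃ (b : Fin k) (i : Fin N) (u : Fin m × Bool), pairPos b (i, u) = t ∧
    gadget (x b i) u = true)

open Classical in
/-- The column bits: the indicator vectors of the column inputs of the gadgets. -/
noncomputable def colBits {k N m : ℕ} (y : Fin k → Fin N → Fin m × Bool) (t : ℕ) : Bool :=
  decide (∃ (b : Fin k) (i : Fin N), pairPos b (i, y b i) = t)

theorem active_blocks_iff {k N m n : ℕ} (hn : 4 * (k * (N * (m * 2))) ≤ n)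
    (x : Fin k → Fin N → Fin m → Bool) (y : Fin k → Fin N → Fin m × Bool) (t : ℕ) :
    active (interleave n (rowBits x) (colBits y)) t = true ↔
      ∃ (b : Fin k) (i : Fin N), pairPos b (i, y b i) = t ∧ gadget (x b i) (y b i) = true := by
  have key : 2 * t + 1 < n → (active (interleave n (rowBits x) (colBits y)) t =
      (rowBits x t && colBits y t)) := by
    intro h
    rw [active, getBit_interleave_even _ _ (by omega), getBit_interleave_odd _ _ h]
  constructor
  · intro h
    rw [key (lt_of_active h), Bool.and_eq_true] at h
    simp only [rowBits, colBits, decide_eq_true_eq] at h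
    obtain ⟨⟨b, i, u, h1, h2⟩, b', i', h3⟩ := h
    obtain ⟨hb, hp⟩ := pairPos_injective (h3.trans h1.symm)
    obtain rfl := Fin.ext hb
    obtain ⟨rfl, rfl⟩ := Prod.mk.inj hp
    exact ⟨_, _, h3, h2⟩
  · rintro ⟨b, i, h1, h2⟩
    have := pairPos_lt_of_lt b.2 (i, y b i)
    rw [key (by omega), Bool.and_eq_true]
    simp only [rowBits, colBits, decide_eq_true_eq]
    exact ⟨⟨b, i, _, h1, h2⟩, b, i, h1⟩

theorem firstActive_blocks_of_first {k N m n : ℕ} (hn : 4 * (k * (N * (m * 2))) ≤ n)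
    (x : Fin k → Fin N → Fin m → Bool) (y : Fin k → Fin N → Fin m × Bool) (b : Fin k)
    (hb : ∃ i, gadget (x b i) (y b i) = true)
    (hz : ∀ b' < b, ¬ ∃ i, gadget (x b' i) (y b' i) = true) :
    firstActive n (interleave n (rowBits x) (colBits y)) = decide ((b : ℕ) % 2 = 1) := by
  classical
  obtain ⟨i, hi⟩ := hb
  have hact := (active_blocks_iff hn x y _).mpr ⟨b, i, rfl, hi⟩
  have hex : ∃ t, active (interleave n (rowBits x) (colBits y)) t = true := ⟨_, hact⟩
  rw [firstActive_of_first (Nat.find_spec hex)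
    fun s hs => by simpa using Nat.find_min hex hs]
  obtain ⟨b₀, i₀, h1, h2⟩ := (active_blocks_iff hn x y _).mp (Nat.find_spec hex)
  have hle : Nat.find hex ≤ pairPos b (i, y b i) := Nat.find_min' hex hact
  have hbb : b₀ = b := by
    rcases lt_trichotomy b₀ b with h | h | h
    · exact absurd ⟨i₀, h2⟩ (hz b₀ h)
    · exact h
    · have := pairPos_lt (show (b : ℕ) < b₀ from h) (i, y b i) (i₀, y b₀ i₀)
      omega
  rw [← h1, pairPos_mod_two, hbb]

theorem firstActive_blocks_of_none {k N m n : ℕ} (hn : 4 * (k * (N * (m * 2))) ≤ n)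
    (x : Fin k → Fin N → Fin m → Bool) (y : Fin k → Fin N → Fin m × Bool)
    (hz : ∀ b, ¬ ∃ i, gadget (x b i) (y b i) = true) :
    firstActive n (interleave n (rowBits x) (colBits y)) = false := by
  refine firstActive_of_none fun t => ?_
  by_contra h
  obtain ⟨b, i, -, h2⟩ := (active_blocks_iff hn x y t).mp (by simpa using h)
  exact hz b ⟨i, h2⟩

/-- The two-party version of the first-active-pair function agrees in sign with a signed matrix of
mass at least `1` and superpolynomially small discrepancy. -/
theorem exists_hard_matrix (e : ℕ) : ∃ (n : ℕ) (X Y : Type) (_ : Fintype X) (_ : Fintype Y)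
    (α : X → ℕ → Bool) (β : Y → ℕ → Bool) (Φ : X → Y → ℝ) (ε : ℝ),
    2 ≤ n ∧ 0 ≤ ε ∧ 4 * ((n : ℝ) ^ e + 2) ^ 2 * ε < 1 ∧ DiscLE Φ ε ∧ 1 ≤ ∑ x, ∑ y, |Φ x y| ∧
    ∀ x y, Φ x y * (if firstActive n (interleave n (α x) (β y)) then -1 else 1) = |Φ x y| := by
  obtain ⟨d, hd⟩ : ∃ d, d = 16 * e + 6 := ⟨_, rfl⟩
  obtain ⟨N, hN⟩ : ∃ N, N = 4 * 16 ^ d := ⟨_, rfl⟩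
  obtain ⟨k, hk⟩ : ∃ k, k = (4 * d + 2) * (d + 1) := ⟨_, rfl⟩
  obtain ⟨m, hm⟩ : ∃ m, m = N * N * (N * N) := ⟨_, rfl⟩
  have hN2 : N = 2 ^ (4 * d + 2) := by
    rw [hN, pow_add, pow_mul]; norm_num [mul_comm]
  have hN4 : 4 ≤ N := by
    rw [hN]; exact Nat.le_mul_of_pos_right _ (by positivity)
  have hkN : k ≤ N := by
    have h1 : d + 1 ≤ 2 ^ d := Nat.lt_two_pow_self
    calc k ≤ (4 * 2 ^ d) * 2 ^ d := by rw [hk]; exact Nat.mul_le_mul (by omega) h1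
      _ ≤ 4 * 16 ^ d := by
        rw [mul_assoc, ← mul_pow]
        exact Nat.mul_le_mul_left _ (Nat.pow_le_pow_left (by norm_num) _)
      _ = N := hN.symm
  obtain ⟨D, Q, P, hb⟩ := exists_hardBlock d hN rfl hm
  have hn : 4 * (k * (N * (m * 2))) ≤ N ^ 8 := by
    calc 4 * (k * (N * (m * 2))) = 8 * k * N ^ 5 := by rw [hm]; ring
      _ ≤ (4 * 4) * N * N ^ 5 := by gcongr; norm_num
      _ ≤ (N * N) * N * N ^ 5 := by gcongr
      _ = N ^ 8 := by ring
  have hNR : (4 : ℝ) ≤ N := by exact_mod_cast hN4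
  have hN0 : (0 : ℝ) < N := by linarith
  have hkpow : (1 / 2 : ℝ) ^ k = (1 / (N : ℝ)) ^ (d + 1) := by
    rw [hk, pow_mul, hN2]; push_cast; rw [one_div_pow]
  refine ⟨N ^ 8, Fin k → Fin N → Fin m → Bool, Fin k → Fin N → Fin m × Bool, inferInstance,
    inferInstance, rowBits, colBits, nested D Q P k, 23 * (1 / (N : ℝ)) ^ (d + 1), ?_,
    by positivity, ?_, ?_, hb.one_le_sum_abs_nested k, fun x y => ?_⟩
  · calc 2 ≤ N ^ 1 := by rw [pow_one]; omega
      _ ≤ N ^ 8 := Nat.pow_le_pow_right (by omega) (by norm_num)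
  · push_cast
    have h1 : ((N : ℝ) ^ 8) ^ e + 2 ≤ N ^ (8 * e + 1) := by
      rw [← pow_mul, pow_succ]
      have : (1 : ℝ) ≤ N ^ (8 * e) := one_le_pow₀ (by linarith)
      nlinarith
    have h2 : (N : ℝ) ^ (d + 1) = (N ^ (8 * e + 1)) ^ 2 * N ^ 5 := by
      rw [← pow_mul, ← pow_add]; congr 1; omega
    have h3 : (4 : ℝ) ^ 5 ≤ N ^ 5 := by gcongr
    have h4 : (0 : ℝ) < (N ^ (8 * e + 1)) ^ 2 := by positivity
    have h5 : (((N : ℝ) ^ 8) ^ e + 2) ^ 2 ≤ (N ^ (8 * e + 1)) ^ 2 := by gcongr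
    rw [one_div_pow, h2, mul_one_div, ← mul_div_assoc, div_lt_one (by positivity)]
    nlinarith
  · refine (hb.discLE_nested k).mono (le_of_eq ?_)
    rw [hkpow]; ring
  · have hkeven : Even k := ⟨(2 * d + 1) * (d + 1), by rw [hk]; ring⟩
    by_cases h : ∃ b, ∃ i, gadget (x b i) (y b i) = true
    · classical
      -- the first block with a nonzero gadget
      obtain ⟨b, hb1, hb2⟩ : ∃ b : Fin k, (∃ i, gadget (x b i) (y b i) = true) ∧
          ∀ b' < b, ¬ ∃ i, gadget (x b' i) (y b' i) = true := by
        obtain ⟨b, hb1, hb2⟩ := WellFounded.has_min (wellFounded_lt (α := Fin k))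
          {b | ∃ i, gadget (x b i) (y b i) = true} h
        exact ⟨b, hb1, fun b' hb' hc => hb2 b' hc hb'⟩
      have hs := hb.nested_sign k x y b hb1 hb2
      rw [firstActive_blocks_of_first hn x y b hb1 hb2]
      rw [pow_add, hkeven.neg_one_pow, one_mul] at hs
      rcases Nat.mod_two_eq_zero_or_one (b : ℕ) with h0 | h0
      · rw [(Nat.even_iff.mpr h0).neg_one_pow, one_mul] at hs
        simp [h0, abs_of_nonneg hs]
      · rw [(Nat.odd_iff.mpr h0).neg_one_pow] at hs
        have : nested D Q P k x y ≤ 0 := by linarith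
        simp [h0, abs_of_nonpos this]
    · push Not at h
      rw [firstActive_blocks_of_none hn x y (by simpa using h)]
      have := hb.nested_nonneg k x y (by simpa using h)
      simp [abs_of_nonneg this]

/-! ### Testing functions of small complexity against a matrix of small discrepancy -/

section
variable {X Y : Type*} [Fintype X] [Fintype Y]

/-- The entrywise inner product of two real matrices. -/
def pairing (Φ g : X → Y → ℝ) : ℝ := ∑ x, ∑ y, Φ x y * g x y

theorem pairing_add (Φ g h : X → Y → ℝ) :
    pairing Φ (fun x y => g x y + h x y) = pairing Φ g + pairing Φ h := by
  simp only [pairing, mul_add, Finset.sum_add_distrib]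

theorem pairing_smul (Φ : X → Y → ℝ) (c : ℝ) (g : X → Y → ℝ) :
    pairing Φ (fun x y => c * g x y) = c * pairing Φ g := by
  simp only [pairing, Finset.mul_sum]
  exact Finset.sum_congr rfl fun x _ => Finset.sum_congr rfl fun y _ => by ring

theorem pairing_sum {ι : Type*} (Φ : X → Y → ℝ) (s : Finset ι) (g : ι → X → Y → ℝ) :
    pairing Φ (fun x y => ∑ i ∈ s, g i x y) = ∑ i ∈ s, pairing Φ (g i) := by
  classical
  induction s using Finset.induction_on with
  | empty => simp [pairing]
  | insert i s hi ih => simp only [Finset.sum_insert hi, pairing_add, ih]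

theorem DiscLE.abs_pairing_one_le {Φ : X → Y → ℝ} {ε : ℝ} (h : DiscLE Φ ε) :
    |pairing Φ fun _ _ => 1| ≤ ε := by
  simpa [pairing] using h (fun _ => 1) (fun _ => 1) (by simp) (by simp)

theorem DiscLE.nonneg {Φ : X → Y → ℝ} {ε : ℝ} (h : DiscLE Φ ε) : 0 ≤ ε :=
  (abs_nonneg _).trans h.abs_pairing_one_le

/-- On interleaved inputs a character is a product of a function of each half. -/
theorem exists_chi_split {n : ℕ} (S : Finset (Fin n)) :
    ∃ u v : (ℕ → Bool) → ℝ, (∀ a, |u a| ≤ 1) ∧ (∀ b, |v b| ≤ 1) ∧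
      ∀ a b, chi S (interleave n a b) = u a * v b := by
  refine ⟨fun a => ∏ i : Fin n, if i ∈ S ∧ (i : ℕ) % 2 = 0 then sg (a (i / 2)) else 1,
    fun b => ∏ i : Fin n, if i ∈ S ∧ ¬ (i : ℕ) % 2 = 0 then sg (b (i / 2)) else 1, ?_, ?_, ?_⟩
  · intro a
    rw [Finset.abs_prod]
    exact (Finset.prod_eq_one fun i _ => by split_ifs <;> simp [abs_sg]).le
  · intro b
    rw [Finset.abs_prod]
    exact (Finset.prod_eq_one fun i _ => by split_ifs <;> simp [abs_sg]).le
  · intro a b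
    rw [chi_eq_prod, ← Finset.prod_mul_distrib]
    refine Finset.prod_congr rfl fun i _ => ?_
    by_cases h1 : i ∈ S <;> by_cases h2 : (i : ℕ) % 2 = 0 <;> simp [h1, h2, interleave, sg]

theorem DiscLE.abs_pairing_chi_le {Φ : X → Y → ℝ} {ε : ℝ} (h : DiscLE Φ ε) {n : ℕ}
    (S : Finset (Fin n)) (α : X → ℕ → Bool) (β : Y → ℕ → Bool) :
    |pairing Φ fun x y => chi S (interleave n (α x) (β y))| ≤ ε := by
  obtain ⟨u, v, hu, hv, huv⟩ := exists_chi_split S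
  simp only [huv]
  exact h (fun x => u (α x)) (fun y => v (β y)) (fun _ => hu _) fun _ => hv _

theorem DiscLE.abs_pairing_bit_le {Φ : X → Y → ℝ} {ε : ℝ} (h : DiscLE Φ ε) {n : ℕ}
    (f : (Fin n → Bool) → Bool) (α : X → ℕ → Bool) (β : Y → ℕ → Bool) :
    |pairing Φ fun x y => bit (f (interleave n (α x) (β y)))| ≤
      (∑ S, |fourierCoeffBool f S|) * ε := by
  simp only [← sum_fourierCoeffBool_mul_chi f]
  rw [pairing_sum Φ Finset.univ
    fun S x y => fourierCoeffBool f S * chi S (interleave n (α x) (β y)), Finset.sum_mul]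
  refine (Finset.abs_sum_le_sum_abs _ _).trans (Finset.sum_le_sum fun S _ => ?_)
  rw [pairing_smul, abs_mul]
  exact mul_le_mul_of_nonneg_left (h.abs_pairing_chi_le S α β) (abs_nonneg _)

/-- On interleaved inputs the number of true inputs of a majority gate is the sum of a bounded
natural number that depends on the first half and a function of the second half. -/
theorem exists_majGate_split {n : ℕ} (g : MajGate n) :
    ∃ (u : (ℕ → Bool) → ℕ) (v : (ℕ → Bool) → ℝ), (∀ a, u a ≤ g.length) ∧
      ∀ a b, (g.map fun w => bit (w.eval (interleave n a b))).sum = u a + v b := by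
  induction g with
  | nil => exact ⟨fun _ => 0, fun _ => 0, by simp, by simp⟩
  | cons w g ih =>
    obtain ⟨u, v, hu, huv⟩ := ih
    -- an input depends on one half only
    have hw : (∃ c : (ℕ → Bool) → Bool, ∀ a b, w.eval (interleave n a b) = c a) ∨
        ∃ c : (ℕ → Bool) → Bool, ∀ a b, w.eval (interleave n a b) = c b := by
      cases w with
      | const c => exact Or.inl ⟨fun _ => c, fun _ _ => rfl⟩
      | var i =>
        by_cases hi : (i : ℕ) % 2 = 0
        · exact Or.inl ⟨fun a => a (i / 2), fun a b => by simp [MajInput.eval, interleave, hi]⟩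
        · exact Or.inr ⟨fun b => b (i / 2), fun a b => by simp [MajInput.eval, interleave, hi]⟩
      | neg i =>
        by_cases hi : (i : ℕ) % 2 = 0
        · exact Or.inl ⟨fun a => !(a (i / 2)), fun a b => by simp [MajInput.eval, interleave, hi]⟩
        · exact Or.inr ⟨fun b => !(b (i / 2)), fun a b => by simp [MajInput.eval, interleave, hi]⟩
    rcases hw with ⟨c, hc⟩ | ⟨c, hc⟩
    · refine ⟨fun a => u a + (c a).toNat, v, fun a => ?_, fun a b => ?_⟩
      · have := hu a
        have := Bool.toNat_le (c a)
        simp only [List.length_cons]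
        omega
      · rw [List.map_cons, List.sum_cons, huv, hc]
        have hbit : ((c a).toNat : ℝ) = bit (c a) := by cases c a <;> simp [bit]
        push_cast
        rw [hbit]
        ring
    · refine ⟨u, fun b => v b + bit (c b), fun a => (hu a).trans (by simp), fun a b => ?_⟩
      rw [List.map_cons, List.sum_cons, huv, hc]
      ring

/-- A majority gate of fan-in `k` is the sum of `k + 1` indicators of rectangles. -/
theorem DiscLE.abs_pairing_majGate_le {Φ : X → Y → ℝ} {ε : ℝ} (h : DiscLE Φ ε) {n : ℕ}
    (g : MajGate n) (α : X → ℕ → Bool) (β : Y → ℕ → Bool) :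
    |pairing Φ fun x y => bit (MajGate.eval g (interleave n (α x) (β y)))| ≤
      (g.length + 1) * ε := by
  obtain ⟨u, v, hu, huv⟩ := exists_majGate_split g
  have e : ∀ x y, bit (MajGate.eval g (interleave n (α x) (β y))) =
      ∑ c ∈ Finset.range (g.length + 1), (if u (α x) = c then 1 else 0) *
        bit (sgn (c + v (β y) - (g.length : ℝ) / 2)) := by
    intro x y
    rw [Finset.sum_eq_single (u (α x))]
    · rw [if_pos rfl, one_mul, MajGate.eval, huv]
    · intro c _ hc
      rw [if_neg hc.symm, zero_mul]
    · intro hc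
      exact absurd (Finset.mem_range.mpr (Nat.lt_succ_of_le (hu _))) hc
  simp only [e]
  rw [pairing_sum Φ (Finset.range (g.length + 1))
    fun c x y => (if u (α x) = c then 1 else 0) * bit (sgn (c + v (β y) - (g.length : ℝ) / 2))]
  refine (Finset.abs_sum_le_sum_abs _ _).trans ((Finset.sum_le_card_nsmul _ _ ε fun c _ => ?_).trans
    (le_of_eq (by rw [Finset.card_range, nsmul_eq_mul]; push_cast; ring)))
  refine h (fun x => if u (α x) = c then 1 else 0)
    (fun y => bit (sgn (c + v (β y) - (g.length : ℝ) / 2))) (fun x => ?_) fun y => ?_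
  · split_ifs <;> simp
  · rw [abs_of_nonneg (bit_nonneg _)]
    exact bit_le_one _

theorem bit_not (b : Bool) : bit (!b) = 1 + -1 * bit b := by cases b <;> simp [bit]

/-- A sum of inputs of a majority gate has a small inner product with `Φ` if all the variables
do. -/
theorem abs_pairing_sum_inputs_le {Φ : X → Y → ℝ} {ε C : ℝ} (h1 : |pairing Φ fun _ _ => 1| ≤ ε)
    (hC : 0 ≤ C) {w : ℕ} (z : X → Y → Fin w → Bool)
    (hz : ∀ j, |pairing Φ fun x y => bit (z x y j)| ≤ C) (g : MajGate w) :
    |pairing Φ fun x y => (g.map fun u => bit (u.eval (z x y))).sum| ≤ g.length * (ε + C) := by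
  have hε : 0 ≤ ε := (abs_nonneg _).trans h1
  induction g with
  | nil => simp [pairing]
  | cons u g ih =>
    have hu : |pairing Φ fun x y => bit (u.eval (z x y))| ≤ ε + C := by
      cases u with
      | const b =>
        have : (fun (x : X) (y : Y) => bit ((MajInput.const b : MajInput w).eval (z x y))) =
            fun x y => bit b * 1 := by
          funext x y; simp [MajInput.eval]
        rw [this, pairing_smul, abs_mul, abs_of_nonneg (bit_nonneg b)]
        have := mul_le_mul (bit_le_one b) h1 (abs_nonneg _) zero_le_one
        linarith
      | var j =>
        have := hz j
        simp only [MajInput.eval]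
        linarith
      | neg j =>
        simp only [MajInput.eval, bit_not]
        rw [pairing_add Φ (fun _ _ => 1) fun x y => -1 * bit (z x y j), pairing_smul]
        refine (abs_add_le _ _).trans (add_le_add h1 ?_)
        rw [abs_mul, abs_neg, abs_one, one_mul]
        exact hz j
    simp only [List.map_cons, List.sum_cons, List.length_cons]
    rw [pairing_add]
    refine (abs_add_le _ _).trans ((add_le_add hu ih).trans (le_of_eq ?_))
    push_cast
    ring

theorem exists_nat_eq_sum_bit {w : ℕ} (g : MajGate w) (z : Fin w → Bool) :
    ∃ c : ℕ, (g.map fun u => bit (u.eval z)).sum = c := by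
  induction g with
  | nil => exact ⟨0, by simp⟩
  | cons u g ih =>
    obtain ⟨c, hc⟩ := ih
    refine ⟨(u.eval z).toNat + c, ?_⟩
    rw [List.map_cons, List.sum_cons, hc]
    cases u.eval z <;> simp [bit]

/-- A majority circuit computing a function that agrees in sign with a matrix of mass at least `1`
and discrepancy at most `ε` has size at least about `ε ^ (-1 / 2)`: the weighted sum at the top
gate stays away from its threshold by `1 / 4`, so its inner product with the matrix is large. -/
theorem DiscLE.le_of_circuit {Φ : X → Y → ℝ} {ε : ℝ} (h : DiscLE Φ ε) {n : ℕ}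
    (C : MajMajCircuit n) (α : X → ℕ → Bool) (β : Y → ℕ → Bool)
    (hΦ : 1 ≤ ∑ x, ∑ y, |Φ x y|)
    (hs : ∀ x y, Φ x y * (if C.eval (interleave n (α x) (β y)) then -1 else 1) = |Φ x y|) :
    1 / 4 ≤ ((C.size : ℝ) + 2) ^ 2 * ε := by
  set z : X → Y → Fin C.width → Bool :=
    fun x y j => MajGate.eval (C.bottom j) (interleave n (α x) (β y))
  set T : X → Y → ℝ := fun x y => (C.top.map fun u => bit (u.eval (z x y))).sum
  have hε := h.nonneg
  have hsize : (C.size : ℝ) = (C.width + 1) + (C.top.length + ∑ j, ((C.bottom j).length : ℝ)) := by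
    rw [MajMajCircuit.size]; push_cast; rfl
  have hsum0 : (0 : ℝ) ≤ ∑ j, ((C.bottom j).length : ℝ) :=
    Finset.sum_nonneg fun _ _ => Nat.cast_nonneg _
  have hT : |pairing Φ T| ≤ C.top.length * (ε + (C.size + 1) * ε) := by
    refine abs_pairing_sum_inputs_le h.abs_pairing_one_le (by positivity) z (fun j => ?_) C.top
    refine (h.abs_pairing_majGate_le (C.bottom j) α β).trans ?_
    have h2 : ((C.bottom j).length : ℝ) ≤ ∑ j, ((C.bottom j).length : ℝ) :=
      Finset.single_le_sum (f := fun j => ((C.bottom j).length : ℝ))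
        (fun _ _ => Nat.cast_nonneg _) (Finset.mem_univ j)
    have h3 : (0 : ℝ) ≤ C.width := Nat.cast_nonneg _
    have h4 : (0 : ℝ) ≤ C.top.length := Nat.cast_nonneg _
    refine mul_le_mul_of_nonneg_right ?_ hε
    linarith
  have hupper : |pairing Φ fun x y => T x y + (-((C.top.length : ℝ) / 2 + 1 / 4)) * 1| ≤
      C.top.length * (ε + (C.size + 1) * ε) + (C.top.length / 2 + 1 / 4) * ε := by
    rw [pairing_add, pairing_smul]
    refine (abs_add_le _ _).trans (add_le_add hT ?_)
    rw [abs_mul, abs_neg, abs_of_nonneg (by positivity)]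
    exact mul_le_mul_of_nonneg_left h.abs_pairing_one_le (by positivity)
  have hlower : 1 / 4 ≤ -pairing Φ fun x y => T x y + (-((C.top.length : ℝ) / 2 + 1 / 4)) * 1 := by
    have : 1 / 4 ≤ ∑ x, ∑ y, 1 / 4 * |Φ x y| := by
      simp only [← Finset.mul_sum]; linarith
    refine this.trans ?_
    simp only [pairing, ← Finset.sum_neg_distrib]
    refine Finset.sum_le_sum fun x _ => Finset.sum_le_sum fun y _ => ?_
    obtain ⟨c, hc⟩ := exists_nat_eq_sum_bit C.top (z x y)
    have hsxy := hs x y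
    have hev : C.eval (interleave n (α x) (β y)) = decide (0 < T x y - (C.top.length : ℝ) / 2) :=
      rfl
    have hTc : T x y = c := hc
    rw [hev] at hsxy
    by_cases hpos : 0 < T x y - (C.top.length : ℝ) / 2
    · have h1 : (C.top.length : ℝ) + 1 ≤ 2 * T x y := by
        rw [hTc] at hpos ⊢
        have : (C.top.length : ℝ) < 2 * c := by linarith
        exact_mod_cast this
      simp only [hpos, decide_true, if_true] at hsxy
      rw [← hsxy]
      have := abs_nonneg (Φ x y)
      nlinarith
    · simp only [hpos, decide_false, Bool.false_eq_true, if_false, mul_one] at hsxy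
      rw [← hsxy]
      have := abs_nonneg (Φ x y)
      nlinarith
  have h1 := hlower.trans ((neg_le_abs _).trans hupper)
  refine h1.trans ?_
  have htop : (C.top.length : ℝ) ≤ C.size := by
    rw [hsize]; linarith [(Nat.cast_nonneg C.width : (0 : ℝ) ≤ C.width)]
  have e : (C.top.length : ℝ) * (ε + (C.size + 1) * ε) + (C.top.length / 2 + 1 / 4) * ε =
      (C.top.length * (C.size + 2) + C.top.length / 2 + 1 / 4) * ε := by ring
  rw [e]
  refine mul_le_mul_of_nonneg_right ?_ hε
  nlinarith [(Nat.cast_nonneg C.size : (0 : ℝ) ≤ C.size)]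

end

/-! ### The separations -/

theorem firstActive_notMem_MAJMAJ : firstActive ∉ MAJMAJ := by
  rintro ⟨p, hp⟩
  obtain ⟨e, he⟩ := exists_eval_le_pow p
  obtain ⟨n, X, Y, _, _, α, β, Φ, ε, hn, hε, hsmall, hdisc, hmass, hsign⟩ := exists_hard_matrix e
  obtain ⟨C, hC, hCf⟩ := hp n
  have h1 := hdisc.le_of_circuit C α β hmass fun x y => by rw [hCf]; exact hsign x y
  have h2 : (C.size : ℝ) ≤ (n : ℝ) ^ e := by exact_mod_cast hC.trans (he n hn)
  have h3 : ((C.size : ℝ) + 2) ^ 2 * ε ≤ ((n : ℝ) ^ e + 2) ^ 2 * ε := by gcongr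
  linarith

theorem firstActive_notMem_PL1 : firstActive ∉ PL1 := by
  rintro ⟨p, hp⟩
  obtain ⟨e, he⟩ := exists_eval_le_pow p
  obtain ⟨n, X, Y, _, _, α, β, Φ, ε, hn, hε, hsmall, hdisc, hmass, hsign⟩ := exists_hard_matrix e
  have h1 := hdisc.abs_pairing_bit_le (firstActive n) α β
  have h2 : ∑ S, |fourierCoeffBool (firstActive n) S| ≤ (n : ℝ) ^ e :=
    (hp n).trans (by exact_mod_cast he n hn)
  have h3 : ∑ x, ∑ y, |Φ x y| = pairing Φ (fun _ _ => 1) +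
      -2 * pairing Φ fun x y => bit (firstActive n (interleave n (α x) (β y))) := by
    rw [← pairing_smul, ← pairing_add, pairing]
    refine Finset.sum_congr rfl fun x _ => Finset.sum_congr rfl fun y _ => ?_
    rw [← hsign]
    cases firstActive n (interleave n (α x) (β y)) <;> norm_num [bit]
  have h4 := (abs_le.mp h1).1
  have h5 := (abs_le.mp hdisc.abs_pairing_one_le).2
  have h6 := mul_le_mul_of_nonneg_right h2 hε
  have h7 : (0 : ℝ) ≤ (n : ℝ) ^ e := by positivity
  have h8 : (1 + 2 * (n : ℝ) ^ e) * ε ≤ 4 * ((n : ℝ) ^ e + 2) ^ 2 * ε := by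
    refine mul_le_mul_of_nonneg_right ?_ hε
    nlinarith
  linarith

end LinearLists

theorem mainTheorem5 :
    (∀ A ∈ ({LinearLists.LDLhat, LinearLists.LDL} : Set (Set LinearLists.BoolFamily)),
      ∀ B ∈ ({LinearLists.PL1, LinearLists.MAJMAJ} : Set (Set LinearLists.BoolFamily)),
        LinearLists.Incomparable A B) ∧
    LinearLists.Incomparable LinearLists.LDL LinearLists.MAJMAJ := by
  have key : ∀ A ∈ ({LinearLists.LDLhat, LinearLists.LDL} : Set (Set LinearLists.BoolFamily)),
      ∀ B ∈ ({LinearLists.PL1, LinearLists.MAJMAJ} : Set (Set LinearLists.BoolFamily)),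
        LinearLists.Incomparable A B := by
    intro A hA B hB
    have hA1 : LinearLists.LDLhat ⊆ A := by
      rcases hA with rfl | rfl
      · exact Set.Subset.rfl
      · exact LinearLists.LDLhat_subset_LDL
    have hA2 : A ⊆ LinearLists.LDL := by
      rcases hA with rfl | rfl
      · exact LinearLists.LDLhat_subset_LDL
      · exact Set.Subset.rfl
    have hf := hA1 LinearLists.firstActive_mem_LDLhat
    rcases hB with rfl | rfl
    · exact ⟨fun h => LinearLists.firstActive_notMem_PL1 (h hf),
        fun h => LinearLists.sinkXor_notMem_LDL (hA2 (h LinearLists.sinkXor_mem_PL1))⟩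
    · exact ⟨fun h => LinearLists.firstActive_notMem_MAJMAJ (h hf),
        fun h => LinearLists.majXor_notMem_LDL (hA2 (h LinearLists.majXor_mem_MAJMAJ))⟩
  exact ⟨key, key _ (Or.inr rfl) _ (Or.inr rfl)⟩
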